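/- For an elliptic curve $W/\mathbb{Q}$ let $c_W=\prod_p [W(\mathbb{Q}_p):W_0(\mathbb{Q}_p)]$ be its global Tamagawa number, where $p$ runs over all primes and $W_0(\mathbb{Q}_p)$ is the subgroup of points of nonsingular reduction on a minimal Weierstrass equation of $W$ at $p$. Let $E/\mathbb{Q}$ be an elliptic curve with a rational point $P\in E(\mathbb{Q})$ of order $5$, and suppose that the quotient curve $\widetilde{E}=E/\langle P\rangle$ also has a rational point of order $5$. If $E$ is not $\mathbb{Q}$-isogenous to the curve $y^2+y=x^3-x^2$ (that is, if $E$ does not lie in the isogeny class with LMFDB label 11.a), then the product of the global Tamagawa numbers $c_W$, over the $\mathbb{Q}$-isomorphism classes of elliptic curves $W/\mathbb{Q}$ that are $\mathbb{Q}$-isogenous to $E$, is divisible by $25$. (There are finitely many such classes; divisibility of the product by $25$ is expressed by saying that every sufficiently large finite partial product is divisible by $25$, which for a finite family means that the product is divisible by $25$.) -/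

import Mathlib

open Filter
open scoped Polynomial.Bivariate WeierstrassCurve.Affine

namespace EllipticTamagawa

noncomputable section

/-! ### Isogenies over `ℚ` -/

open scoped Classical in
/-- An isogeny `W → W'` defined over `ℚ`, given by its effect on geometric points: a homomorphism
`W(ℚ̄) → W'(ℚ̄)` which, at all points outside the zero locus of some polynomial `d` that does not
vanish identically on `W`, is given by two rational functions `f / d` and `g / d` with rational
coefficients.  Since points where `d ≠ 0` exist and are sent to affine points, the zero
homomorphism is excluded, so these are precisely the nonconstant morphisms of curves over `ℚ`
sending `O` to `O`. -/
structure Isogeny (W W' : WeierstrassCurve ℚ) where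
  toHom : (W.baseChange (AlgebraicClosure ℚ)).toAffine.Point →+
    (W'.baseChange (AlgebraicClosure ℚ)).toAffine.Point
  rational : ∃ f g d : ℚ[X][Y],
    (∃ x y : AlgebraicClosure ℚ, (W.baseChange (AlgebraicClosure ℚ)).toAffine.Nonsingular x y ∧
      Polynomial.aevalAeval x y d ≠ 0) ∧
    ∀ (x y : AlgebraicClosure ℚ)
      (h : (W.baseChange (AlgebraicClosure ℚ)).toAffine.Nonsingular x y),
      Polynomial.aevalAeval x y d ≠ 0 →
        ∃ h' : (W'.baseChange (AlgebraicClosure ℚ)).toAffine.Nonsingular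
            (Polynomial.aevalAeval x y f / Polynomial.aevalAeval x y d)
            (Polynomial.aevalAeval x y g / Polynomial.aevalAeval x y d),
          toHom (.some x y h) = .some _ _ h'

/-- `W'` is isogenous to `W` over `ℚ`. -/
def Isogenous (W W' : WeierstrassCurve ℚ) : Prop := Nonempty (Isogeny W W')

open scoped Classical in
/-- `W'` is (a model of) the quotient curve `W / ⟨P⟩`: the target of an isogeny from `W`, over
`ℚ`, whose kernel on geometric points is the subgroup generated by the rational point `P`.
In characteristic zero this determines `W'` up to isomorphism over `ℚ`. -/
def IsQuotientBy (W : WeierstrassCurve ℚ) (P : (W.baseChange ℚ).toAffine.Point)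
    (W' : WeierstrassCurve ℚ) : Prop :=
  ∃ φ : Isogeny W W', φ.toHom.ker =
    AddSubgroup.zmultiples (WeierstrassCurve.Affine.Point.baseChange ℚ (AlgebraicClosure ℚ) P)

/-! ### Tamagawa numbers -/

section Local

variable (R : Type*) [CommRing R] [IsDomain R] [IsDiscreteValuationRing R]
variable {K : Type*} [Field K] [Algebra R K] [IsFractionRing R K]

/-- The point of `W(K)` has nonsingular reduction, for a minimal Weierstrass equation `W`.  The
point `O`, and every affine point whose coordinates are not both integral, reduces to the point at
infinity, which is nonsingular. -/
def NonsingularReduction (W : WeierstrassCurve K) [W.IsMinimal R] : W.toAffine.Point → Prop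
  | .zero => True
  | .some x y _ => ∀ x₀ y₀ : R, algebraMap R K x₀ = x → algebraMap R K y₀ = y →
      (W.reduction R).toAffine.Nonsingular
        (IsLocalRing.residue R x₀) (IsLocalRing.residue R y₀)

open scoped Classical in
/-- The subgroup `E₀(K)` of points of nonsingular reduction of a minimal Weierstrass equation.
(The set of these points is a subgroup, so it agrees with the subgroup it generates.) -/
def nonsingularSubgroup (W : WeierstrassCurve K) [W.IsMinimal R] :
    AddSubgroup W.toAffine.Point :=
  AddSubgroup.closure {P | NonsingularReduction R W P}

open scoped Classical in
/-- The local Tamagawa number `[E(K) : E₀(K)]`, computed on a minimal Weierstrass equation. -/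
def localTamagawa (W : WeierstrassCurve K) : ℕ :=
  (nonsingularSubgroup R (W.minimal R)).index

end Local

/-- The local Tamagawa number at `p` of a Weierstrass curve over `ℚ`. -/
def tamagawaAt (W : WeierstrassCurve ℚ) (p : ℕ) [Fact p.Prime] : ℕ :=
  localTamagawa ℤ_[p] (W.baseChange ℚ_[p])

/-- The global Tamagawa number: the product over all primes of the local Tamagawa numbers
(all but finitely many of which are `1` when the curve is elliptic). -/
def tamagawa (W : WeierstrassCurve ℚ) : ℕ :=
  ∏ᶠ p : Nat.Primes, haveI : Fact (p : ℕ).Prime := ⟨p.2⟩; tamagawaAt W p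

/-! ### Isogeny classes -/

/-- The relation of `ℚ`-isomorphism on the elliptic curves isogenous to `E`. -/
def isomSetoid (E : WeierstrassCurve ℚ) :
    Setoid {W : WeierstrassCurve ℚ // W.IsElliptic ∧ Isogenous E W} :=
  (MulAction.orbitRel (WeierstrassCurve.VariableChange ℚ) (WeierstrassCurve ℚ)).comap
    Subtype.val

/-- The isogeny class of `E`: elliptic curves over `ℚ` isogenous to `E`, up to `ℚ`-isomorphism. -/
def IsogenyClass (E : WeierstrassCurve ℚ) : Type := Quotient (isomSetoid E)

/-- The global Tamagawa number of a member of the isogeny class.  It depends only on the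
isomorphism class, so it can be computed on any representative. -/
def IsogenyClass.tamagawa {E : WeierstrassCurve ℚ} (C : IsogenyClass E) : ℕ :=
  EllipticTamagawa.tamagawa (Quotient.out C).1

/-- `n` divides the product of the numbers `f i` over the whole index type: it divides every
sufficiently large finite partial product.  For a finite index type (such as the isogeny class of
an elliptic curve over `ℚ`) this says exactly that `n` divides the product, see
`dvdProduct_iff_of_fintype`. -/
def DvdProduct {ι : Type*} (n : ℕ) (f : ι → ℕ) : Prop :=
  ∀ᶠ S : Finset ι in atTop, n ∣ ∏ i ∈ S, f i

theorem dvdProduct_iff_of_fintype {ι : Type*} [Fintype ι] (n : ℕ) (f : ι → ℕ) :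
    DvdProduct n f ↔ n ∣ ∏ i, f i := by
  rw [DvdProduct, OrderTop.atTop_eq, eventually_pure, Finset.top_eq_univ]

/-- The elliptic curve `y² + y = x³ - x²` of conductor `11`, a model of `X₁(11)`.  It has LMFDB
label 11.a3, so its isogeny class is 11.a. -/
def curve11a3 : WeierstrassCurve ℚ := ⟨0, -1, 1, 0, 0⟩

end

end EllipticTamagawa

/-!
The isomorphism class of `E` alone contributes a factor `25` to the product, already through its
local Tamagawa number at a single prime.

An elliptic curve with a rational point `P` of order `5` has a Tate normal form
`E_t : y² + (1 - t)xy - ty = x³ - tx²` with `P = (0, 0)` and `Δ = t⁵(t² - 11t - 1)`. The function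
`f = (x + 1)y - x²` has divisor `5P - 5O`, so (with the value `1 / t` at `P`) it induces a
homomorphism from `E_t(F)` to `Fˣ` modulo fifth powers (`descentFun_add`).

*The parameter is a fifth power* (`exists_tateCurve_pow_five`). A rational point of order `5` on
`E / ⟨P⟩` lifts to a geometric point `R` with `σ R - R ∈ ⟨P⟩` for all `σ` in the absolute Galois
group and `5 R = j P`; this needs that an isogeny is surjective on geometric points and commutes
with the Galois action. Since `P` is rational, `R` is defined over the field of numbers fixed by
all `σ⁵`. That field does not contain `√5`, since the action of `σ` on a quadratic field has order
dividing `2`, prime to `5`. If `5 ∣ j`, then `R` has order `5` and lies outside `⟨P⟩`, and the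
`5`-division polynomial shows that `√5` lies in the field generated by the coordinates of `R`
(`five_mul_sq_of_torsion`). Otherwise `descentFun_nsmul` makes a power of `t` with exponent prime
to `5` the fifth power of a number fixed by all `σ⁵`, and then `t` is the fifth power of a rational
number, because the field contains no primitive fifth root of unity (which would generate `√5`).

*The local computation* (`dvd_localTamagawa`). Let `t = s⁵`. If `s = 1` or `s = -1`, then `E` is
isomorphic to `y² + y = x³ - x²`, which is excluded. Otherwise some prime `p` divides the numerator
or the denominator of `s`, and since `E_t` and `E_{-1/t}` are isomorphic (`tateCurve_neg_inv`), one
may assume `v_p(s) > 0`. The reduction of `E_t` at `p` then has a node at `(0, 0)`. The valuation of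
the descent function modulo `5` is trivial on points of nonsingular reduction, trivial at `P`
because `5 ∣ v_p(t)`, and onto `ℤ/5` by Hensel's lemma. As `P` reduces to the node, the component
group has a subgroup of order `5` inside the kernel of a surjection onto `ℤ/5`, whence the
factor `25`. Finally `E_t` is minimal at `p`, so that any minimal equation gives the same index
(`integral_of_isMinimal_tateCurve`), and the global Tamagawa number is a product with finite
support (`finite_tamagawaAt_ne_one`), hence divisible by its factor at `p`.
-/

namespace EllipticTamagawa

open WeierstrassCurve

/-! ### Lines and changes of variables -/

section Line

variable {F : Type*} [Field F] [DecidableEq F]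

/-- Two points with `A + B ≠ 0` lie on a line `Y = ℓ X + ν`, whose third point of intersection is
`-(A + B)`; the last three equations are Vieta's formulas for the cubic cut out by this line. -/
theorem exists_line {W : WeierstrassCurve F} {x₁ y₁ x₂ y₂ : F} (h₁ : W.toAffine.Nonsingular x₁ y₁)
    (h₂ : W.toAffine.Nonsingular x₂ y₂) (hxy : ¬(x₁ = x₂ ∧ y₁ = W.toAffine.negY x₂ y₂)) :
    ∃ (ℓ ν x₃ : F) (h₃ : W.toAffine.Nonsingular x₃ (ℓ * x₃ + ν)),
      Affine.Point.some x₁ y₁ h₁ + .some x₂ y₂ h₂ = -.some x₃ _ h₃ ∧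
      y₁ = ℓ * x₁ + ν ∧ y₂ = ℓ * x₂ + ν ∧
      x₁ + x₂ + x₃ = ℓ ^ 2 + W.a₁ * ℓ - W.a₂ ∧
      x₁ * x₂ + x₁ * x₃ + x₂ * x₃ = W.a₄ - 2 * ℓ * ν - W.a₁ * ν - W.a₃ * ℓ ∧
      x₁ * x₂ * x₃ = ν ^ 2 + W.a₃ * ν - W.a₆ := by
  have key := Affine.addPolynomial_slope h₁.1 h₂.1 hxy
  have hy : y₂ = W.toAffine.slope x₁ x₂ y₁ y₂ * (x₂ - x₁) + y₁ := by
    by_cases hx : x₁ = x₂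
    · subst hx
      have := Affine.Y_eq_of_Y_ne h₁.1 h₂.1 rfl (fun h => hxy ⟨rfl, h⟩)
      simp [this]
    · rw [Affine.slope_of_X_ne hx]
      have := sub_ne_zero.2 hx
      field_simp
      ring
  set ℓ := W.toAffine.slope x₁ x₂ y₁ y₂ with hℓ
  have hn := Affine.nonsingular_negAdd h₁ h₂ hxy
  rw [Affine.addPolynomial_eq, neg_inj, Cubic.prod_X_sub_C_eq, Cubic.toPoly_injective] at key
  rw [Cubic.mk.injEq] at key
  obtain ⟨-, e1, e2, e3⟩ := key
  have hl : W.toAffine.negAddY x₁ x₂ y₁ ℓ = ℓ * W.toAffine.addX x₁ x₂ ℓ + (y₁ - ℓ * x₁) := by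
    simp only [Affine.negAddY]; ring
  rw [hl] at hn
  refine ⟨ℓ, y₁ - ℓ * x₁, _, hn, ?_, by ring, by linear_combination hy, ?_, ?_, ?_⟩
  · rw [Affine.Point.add_some hxy, Affine.Point.neg_some]
    congr 1
    rw [Affine.addY, hl]
  · linear_combination e1
  · linear_combination -e2
  · linear_combination e3

end Line

section VariableChange

variable {F : Type*} [Field F]

theorem equation_variableChange (W : WeierstrassCurve F) (C : VariableChange F) (x y : F) :
    (C • W).toAffine.Equation x y ↔ W.toAffine.Equation ((C.u : F) ^ 2 * x + C.r)
      ((C.u : F) ^ 3 * y + (C.u : F) ^ 2 * C.s * x + C.t) := by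
  have hu : (C.u : F) ≠ 0 := C.u.ne_zero
  rw [Affine.equation_iff', Affine.equation_iff']
  simp only [variableChange_a₁, variableChange_a₂, variableChange_a₃, variableChange_a₄,
    variableChange_a₆, Units.val_inv_eq_inv_val]
  rw [← mul_eq_zero_iff_left (pow_ne_zero 6 hu)]
  field_simp
  rw [← sub_eq_zero, iff_iff_eq]
  congr 1
  ring

theorem nonsingular_variableChange (W : WeierstrassCurve F) (C : VariableChange F) (x y : F) :
    (C • W).toAffine.Nonsingular x y ↔ W.toAffine.Nonsingular ((C.u : F) ^ 2 * x + C.r)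
      ((C.u : F) ^ 3 * y + (C.u : F) ^ 2 * C.s * x + C.t) := by
  have hu : (C.u : F) ≠ 0 := C.u.ne_zero
  rw [Affine.nonsingular_iff', Affine.nonsingular_iff', equation_variableChange]
  refine and_congr_right fun _ => ?_
  set U := (C.u : F) ^ 2 * x + C.r with hU
  set V := (C.u : F) ^ 3 * y + (C.u : F) ^ 2 * C.s * x + C.t with hV
  have e1 : (C • W).a₁ * y - (3 * x ^ 2 + 2 * (C • W).a₂ * x + (C • W).a₄) =
      (C.u : F)⁻¹ ^ 4 * (W.a₁ * V - (3 * U ^ 2 + 2 * W.a₂ * U + W.a₄) +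
        C.s * (2 * V + W.a₁ * U + W.a₃)) := by
    simp only [variableChange_a₁, variableChange_a₂, variableChange_a₄,
      Units.val_inv_eq_inv_val, hU, hV]
    field_simp
    ring
  have e2 : 2 * y + (C • W).a₁ * x + (C • W).a₃ =
      (C.u : F)⁻¹ ^ 3 * (2 * V + W.a₁ * U + W.a₃) := by
    simp only [variableChange_a₁, variableChange_a₃, Units.val_inv_eq_inv_val, hU, hV]
    field_simp
    ring
  rw [e1, e2, mul_ne_zero_iff, mul_ne_zero_iff]
  have h4 : (C.u : F)⁻¹ ^ 4 ≠ 0 := pow_ne_zero _ (inv_ne_zero hu)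
  have h3 : (C.u : F)⁻¹ ^ 3 ≠ 0 := pow_ne_zero _ (inv_ne_zero hu)
  simp only [h4, h3, ne_eq, not_false_eq_true, true_and]
  by_cases hz : 2 * V + W.a₁ * U + W.a₃ = 0
  · simp [hz]
  · simp [hz]

/-- The map on points induced by an admissible change of variables. -/
def variableChangeFun (W : WeierstrassCurve F) (C : VariableChange F) :
    (C • W).toAffine.Point → W.toAffine.Point
  | .zero => .zero
  | .some x y h => .some _ _ ((nonsingular_variableChange W C x y).1 h)

theorem variableChangeFun_bijective (W : WeierstrassCurve F) (C : VariableChange F) :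
    Function.Bijective (variableChangeFun W C) := by
  have hu : (C.u : F) ≠ 0 := C.u.ne_zero
  constructor
  · rintro (_ | ⟨x, y, h⟩) (_ | ⟨x', y', h'⟩) H
    · rfl
    · cases H
    · cases H
    · simp only [variableChangeFun, Affine.Point.some.injEq] at H
      have hx : x = x' := mul_left_cancel₀ (pow_ne_zero 2 hu) (add_right_cancel H.1)
      subst hx
      have hy : y = y' := mul_left_cancel₀ (pow_ne_zero 3 hu)
        (add_right_cancel (add_right_cancel H.2))
      subst hy
      rfl
  · rintro (_ | ⟨x, y, h⟩)
    · exact ⟨.zero, rfl⟩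
    · have hx : (C.u : F) ^ 2 * ((x - C.r) / (C.u : F) ^ 2) + C.r = x := by
        field_simp; ring
      have hy : (C.u : F) ^ 3 * ((y - C.s * (x - C.r) - C.t) / (C.u : F) ^ 3) +
          (C.u : F) ^ 2 * C.s * ((x - C.r) / (C.u : F) ^ 2) + C.t = y := by
        field_simp; ring
      refine ⟨.some ((x - C.r) / (C.u : F) ^ 2) ((y - C.s * (x - C.r) - C.t) / (C.u : F) ^ 3)
        ((nonsingular_variableChange W C _ _).2 (by rwa [hx, hy])), ?_⟩
      simp only [variableChangeFun, Affine.Point.some.injEq]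
      exact ⟨hx, hy⟩

theorem variableChange_negY (W : WeierstrassCurve F) (C : VariableChange F) (x y : F) :
    (C.u : F) ^ 3 * (C • W).toAffine.negY x y + (C.u : F) ^ 2 * C.s * x + C.t =
      W.toAffine.negY ((C.u : F) ^ 2 * x + C.r)
        ((C.u : F) ^ 3 * y + (C.u : F) ^ 2 * C.s * x + C.t) := by
  have hu : (C.u : F) ≠ 0 := C.u.ne_zero
  simp only [Affine.negY, variableChange_a₁, variableChange_a₃, Units.val_inv_eq_inv_val]
  field_simp
  ring

theorem variableChangeFun_add [DecidableEq F] (W : WeierstrassCurve F) (C : VariableChange F)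
    (A B : (C • W).toAffine.Point) :
    variableChangeFun W C (A + B) = variableChangeFun W C A + variableChangeFun W C B := by
  have hu : (C.u : F) ≠ 0 := C.u.ne_zero
  rcases A with _ | ⟨x₁, y₁, h₁⟩
  · change variableChangeFun W C (0 + B) = 0 + variableChangeFun W C B
    rw [zero_add, zero_add]
  rcases B with _ | ⟨x₂, y₂, h₂⟩
  · change variableChangeFun W C (_ + 0) = variableChangeFun W C _ + 0
    rw [add_zero, add_zero]
  have hxx : (C.u : F) ^ 2 * x₁ + C.r = (C.u : F) ^ 2 * x₂ + C.r ↔ x₁ = x₂ := by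
    simp [hu]
  by_cases hxy : x₁ = x₂ ∧ y₁ = (C • W).toAffine.negY x₂ y₂
  · rw [Affine.Point.add_of_Y_eq hxy.1 hxy.2]
    simp only [variableChangeFun]
    rw [Affine.Point.add_of_Y_eq (hxx.2 hxy.1)]
    · rfl
    · rw [← variableChange_negY, hxy.1, hxy.2]
  · have hxy' : ¬((C.u : F) ^ 2 * x₁ + C.r = (C.u : F) ^ 2 * x₂ + C.r ∧
        (C.u : F) ^ 3 * y₁ + (C.u : F) ^ 2 * C.s * x₁ + C.t =
          W.toAffine.negY ((C.u : F) ^ 2 * x₂ + C.r)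
            ((C.u : F) ^ 3 * y₂ + (C.u : F) ^ 2 * C.s * x₂ + C.t)) := by
      rintro ⟨hx, hy⟩
      rw [hxx] at hx
      subst hx
      rw [← variableChange_negY] at hy
      exact hxy ⟨rfl, mul_left_cancel₀ (pow_ne_zero 3 hu)
        (add_right_cancel (add_right_cancel hy))⟩
    have hs : W.toAffine.slope ((C.u : F) ^ 2 * x₁ + C.r) ((C.u : F) ^ 2 * x₂ + C.r)
        ((C.u : F) ^ 3 * y₁ + (C.u : F) ^ 2 * C.s * x₁ + C.t)
        ((C.u : F) ^ 3 * y₂ + (C.u : F) ^ 2 * C.s * x₂ + C.t) =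
        C.u * (C • W).toAffine.slope x₁ x₂ y₁ y₂ + C.s := by
      by_cases hx : x₁ = x₂
      · subst hx
        have hy : y₁ ≠ (C • W).toAffine.negY x₁ y₂ := fun h => hxy ⟨rfl, h⟩
        have hy' := fun h => hxy' ⟨rfl, h⟩
        have hyy := Affine.Y_eq_of_Y_ne h₁.1 h₂.1 rfl hy
        subst hyy
        rw [Affine.slope_of_Y_ne rfl hy, Affine.slope_of_Y_ne rfl hy', ← variableChange_negY]
        have hd : y₁ - (C • W).toAffine.negY x₁ y₁ ≠ 0 := sub_ne_zero.2 hy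
        have hd' : (C.u : F) ^ 3 * y₁ + (C.u : F) ^ 2 * C.s * x₁ + C.t - ((C.u : F) ^ 3 *
            (C • W).toAffine.negY x₁ y₁ + (C.u : F) ^ 2 * C.s * x₁ + C.t) =
            (C.u : F) ^ 3 * (y₁ - (C • W).toAffine.negY x₁ y₁) := by ring
        rw [hd', div_eq_iff (mul_ne_zero (pow_ne_zero 3 hu) hd)]
        have e : ∀ a b c d : F, d ≠ 0 → (a * (b / d) + c) * (a ^ 3 * d) =
            a ^ 4 * b + c * a ^ 3 * d := by
          intro a b c d hd; field_simp
        rw [e _ _ _ _ hd]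
        simp only [Affine.negY, variableChange_a₁, variableChange_a₂, variableChange_a₃,
          variableChange_a₄, Units.val_inv_eq_inv_val]
        field_simp
        ring
      · rw [Affine.slope_of_X_ne hx, Affine.slope_of_X_ne (fun h => hx (hxx.1 h))]
        have hd : x₁ - x₂ ≠ 0 := sub_ne_zero.2 hx
        have hd' : (C.u : F) ^ 2 * x₁ + C.r - ((C.u : F) ^ 2 * x₂ + C.r) =
          (C.u : F) ^ 2 * (x₁ - x₂) := by ring
        rw [hd']
        field_simp
        ring
    have hX : W.toAffine.addX ((C.u : F) ^ 2 * x₁ + C.r) ((C.u : F) ^ 2 * x₂ + C.r)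
        (C.u * (C • W).toAffine.slope x₁ x₂ y₁ y₂ + C.s) = (C.u : F) ^ 2 *
          (C • W).toAffine.addX x₁ x₂ ((C • W).toAffine.slope x₁ x₂ y₁ y₂) + C.r := by
      simp only [Affine.addX, variableChange_a₁, variableChange_a₂, Units.val_inv_eq_inv_val]
      field_simp
      ring
    rw [Affine.Point.add_some hxy]
    simp only [variableChangeFun]
    rw [Affine.Point.add_some hxy', Affine.Point.some.injEq, hs]
    refine ⟨hX.symm, ?_⟩
    rw [Affine.addY, Affine.addY, Affine.negAddY, Affine.negAddY, hX, variableChange_negY]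
    congr 1
    ring

/-- An admissible change of variables induces an isomorphism of groups of points. -/
theorem exists_pointEquiv [DecidableEq F] {W W' : WeierstrassCurve F} {C : VariableChange F}
    (h : C • W = W') : ∃ e : W'.toAffine.Point ≃+ W.toAffine.Point,
      ∀ x y (hxy : W'.toAffine.Nonsingular x y), ∃ h', e (.some x y hxy) =
        .some ((C.u : F) ^ 2 * x + C.r) ((C.u : F) ^ 3 * y + (C.u : F) ^ 2 * C.s * x + C.t) h' := by
  subst h
  refine ⟨AddEquiv.ofBijective (AddMonoidHom.mk' (variableChangeFun W C)
    (variableChangeFun_add W C)) (variableChangeFun_bijective W C), fun x y hxy => ⟨_, rfl⟩⟩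

end VariableChange

/-! ### The Tate normal form and its descent function -/

section TateCurve

variable {F : Type*} [Field F]

/-- Tate's normal form of an elliptic curve with a point of order `5`, namely `(0, 0)`:
the curve `y² + (1 - t)xy - ty = x³ - tx²`. -/
def tateCurve (t : F) : WeierstrassCurve F := ⟨1 - t, -t, -t, 0, 0⟩

theorem tateCurve_Δ (t : F) : (tateCurve t).Δ = t ^ 5 * (t ^ 2 - 11 * t - 1) := by
  simp only [tateCurve, WeierstrassCurve.Δ, WeierstrassCurve.b₂, WeierstrassCurve.b₄,
    WeierstrassCurve.b₆, WeierstrassCurve.b₈]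
  ring

theorem tateCurve_equation {t x y : F} : (tateCurve t).toAffine.Equation x y ↔
    y ^ 2 + (1 - t) * x * y - t * y = x ^ 3 - t * x ^ 2 := by
  rw [Affine.equation_iff, tateCurve]
  simp only [zero_mul, add_zero, neg_mul, ← sub_eq_add_neg]

theorem tateCurve_nonsingular_zero {t : F} (ht : t ≠ 0) :
    (tateCurve t).toAffine.Nonsingular 0 0 := by
  rw [Affine.nonsingular_zero]
  simp [tateCurve, ht]

/-- The point `(0, 0)` of order `5` on the Tate normal form. -/
def tatePoint {t : F} (ht : t ≠ 0) : (tateCurve t).toAffine.Point :=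
  .some 0 0 (tateCurve_nonsingular_zero ht)

/-- The polynomial `(x + 1)y - x²` has divisor `5P - 5O` on the Tate normal form, so it vanishes
at `P = (0, 0)` only. -/
theorem eq_zero_of_descent_eq_zero {t x y : F} (h : (tateCurve t).toAffine.Equation x y)
    (h0 : (x + 1) * y - x ^ 2 = 0) : x = 0 ∧ y = 0 := by
  rw [tateCurve_equation] at h
  have hx : x ^ 5 = 0 := by
    -- the product of the values at `(x, y)` and at its negative is `-x ^ 5`
    linear_combination (-(x + 1) ^ 2) * h +
      (-((x + 1) * (-y - (1 - t) * x + t) - x ^ 2)) * h0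
  have hx : x = 0 := by simpa using hx
  subst hx
  simpa using h0

open scoped Classical in
/-- The descent function attached to the point `P = (0, 0)` of order `5`: the function
`(x + 1)y - x²` with divisor `5P - 5O`, whose values at `O` and `P` are replaced by the ones that
make it multiplicative modulo fifth powers. -/
noncomputable def descentFun (t : F) : (tateCurve t).toAffine.Point → F
  | .zero => 1
  | .some x y _ => if x = 0 ∧ y = 0 then t⁻¹ else (x + 1) * y - x ^ 2

theorem descentFun_zero (t : F) : descentFun t 0 = 1 := rfl

theorem descentFun_tatePoint {t : F} (ht : t ≠ 0) : descentFun t (tatePoint ht) = t⁻¹ := by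
  simp [descentFun, tatePoint]

theorem descentFun_some {t x y : F} (h : (tateCurve t).toAffine.Nonsingular x y)
    (h0 : ¬(x = 0 ∧ y = 0)) : descentFun t (.some x y h) = (x + 1) * y - x ^ 2 := by
  simp [descentFun, h0]

theorem descentFun_ne_zero {t : F} (ht : t ≠ 0) (A : (tateCurve t).toAffine.Point) :
    descentFun t A ≠ 0 := by
  rcases A with _ | ⟨x, y, h⟩
  · exact one_ne_zero
  · by_cases h0 : x = 0 ∧ y = 0
    · simp [descentFun, h0, ht]
    · rw [descentFun_some h h0]
      exact fun H => h0 (eq_zero_of_descent_eq_zero h.1 H)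

theorem descentFun_neg {t : F} (ht : t ≠ 0) (A : (tateCurve t).toAffine.Point) :
    ∃ c : F, c ≠ 0 ∧ descentFun t (-A) * descentFun t A = c ^ 5 := by
  rcases A with _ | ⟨x, y, h⟩
  · exact ⟨1, one_ne_zero, by simp [← Affine.Point.zero_def, descentFun_zero]⟩
  have hn : (tateCurve t).toAffine.negY x y = -y - (1 - t) * x + t := by
    simp [Affine.negY, tateCurve]
  have he := tateCurve_equation.1 h.1
  rw [Affine.Point.neg_some]
  by_cases hx : x = 0
  · subst hx
    have hy : y * (y - t) = 0 := by linear_combination he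
    refine ⟨1, one_ne_zero, ?_⟩
    rcases mul_eq_zero.1 hy with rfl | hy
    · rw [descentFun_some _ (by simp [tateCurve, ht]), hn]
      simp [descentFun, ht]
    · obtain rfl : y = t := by linear_combination hy
      rw [descentFun_some h (by simp [ht])]
      simp [descentFun, tateCurve, ht]
  · refine ⟨-x, neg_ne_zero.2 hx, ?_⟩
    rw [descentFun_some _ (by simp [hx]), descentFun_some _ (by simp [hx]), hn]
    linear_combination (-(x + 1) ^ 2) * he

/-- Weil reciprocity for the descent function and a line: the product of its values at three
collinear points is a fifth power. -/
theorem descentFun_line {t : F} (ht : t ≠ 0) {ℓ ν x₁ x₂ x₃ y₁ y₂ y₃ : F}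
    (h₁ : (tateCurve t).toAffine.Nonsingular x₁ y₁) (h₂ : (tateCurve t).toAffine.Nonsingular x₂ y₂)
    (h₃ : (tateCurve t).toAffine.Nonsingular x₃ y₃)
    (e₁ : y₁ = ℓ * x₁ + ν) (e₂ : y₂ = ℓ * x₂ + ν) (e₃ : y₃ = ℓ * x₃ + ν)
    (s₁ : x₁ + x₂ + x₃ = ℓ ^ 2 + (1 - t) * ℓ + t)
    (s₂ : x₁ * x₂ + x₁ * x₃ + x₂ * x₃ = -2 * ℓ * ν - (1 - t) * ν + t * ℓ)
    (s₃ : x₁ * x₂ * x₃ = ν ^ 2 - t * ν) :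
    ∃ c : F, c ≠ 0 ∧
      descentFun t (.some _ _ h₁) * descentFun t (.some _ _ h₂) * descentFun t (.some _ _ h₃) =
        c ^ 5 := by
  by_cases hν : ν = 0
  · -- the line passes through `P`; first the case where `x₁ = 0`, so that the first point is `P`
    subst hν
    simp only [add_zero, ne_eq, OfNat.ofNat_ne_zero, not_false_eq_true, zero_pow, mul_zero,
      sub_zero, zero_add, mul_eq_zero] at e₁ e₂ e₃ s₂ s₃
    have main : ∀ {x y x' y' : F} (h : (tateCurve t).toAffine.Nonsingular x y)
        (h' : (tateCurve t).toAffine.Nonsingular x' y'), y = ℓ * x → y' = ℓ * x' →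
        x + x' = ℓ ^ 2 + (1 - t) * ℓ + t → x * x' = t * ℓ →
        ∃ c : F, c ≠ 0 ∧ t⁻¹ * (descentFun t (.some _ _ h) * descentFun t (.some _ _ h')) =
          c ^ 5 := by
      have tangent : ∀ {x y x' y' : F} (h : (tateCurve t).toAffine.Nonsingular x y)
          (h' : (tateCurve t).toAffine.Nonsingular x' y'), y = ℓ * x → y' = ℓ * x' →
          x + x' = ℓ ^ 2 + (1 - t) * ℓ + t → x * x' = t * ℓ → x = 0 →
          ∃ c : F, c ≠ 0 ∧ t⁻¹ * (descentFun t (.some _ _ h) * descentFun t (.some _ _ h')) =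
            c ^ 5 := by
        intro x y x' y' h h' e e' s p hx
        subst hx
        have hℓ : ℓ = 0 := by simpa [ht] using p.symm
        subst hℓ
        have hx' : x' = t := by linear_combination s
        simp only [zero_mul] at e e'
        subst hx' e e'
        refine ⟨-1, by simp, ?_⟩
        rw [descentFun_some h' (by simp [ht])]
        simp only [descentFun, and_self, if_true]
        field_simp
        ring
      intro x y x' y' h h' e e' s p
      by_cases hx : x = 0
      · exact tangent h h' e e' s p hx
      by_cases hx' : x' = 0
      · rw [mul_comm (descentFun t _)]
        exact tangent h' h e' e (by rw [add_comm, s]) (by rw [mul_comm, p]) hx'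
      refine ⟨ℓ, ?_, ?_⟩
      · rintro rfl
        rw [mul_zero] at p
        exact (mul_ne_zero hx hx') p
      · rw [descentFun_some h (by simp [hx]), descentFun_some h' (by simp [hx']), e, e',
          inv_mul_eq_iff_eq_mul₀ ht]
        linear_combination ((ℓ - 1) ^ 2 * x * x' + (ℓ - 1) * ℓ * (x + x') + ℓ ^ 2) * p +
          t * ℓ * (ℓ - 1) ^ 2 * p + t * ℓ * (ℓ - 1) * ℓ * s
    rcases s₃ with (rfl | rfl) | rfl
    · simp only [mul_zero] at e₁
      subst e₁
      obtain ⟨c, hc, h⟩ := main h₂ h₃ e₂ e₃ (by linear_combination s₁) (by linear_combination s₂)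
      refine ⟨c, hc, ?_⟩
      rw [← h, mul_assoc]
      simp [descentFun]
    · simp only [mul_zero] at e₂
      subst e₂
      obtain ⟨c, hc, h⟩ := main h₁ h₃ e₁ e₃ (by linear_combination s₁) (by linear_combination s₂)
      refine ⟨c, hc, ?_⟩
      rw [← h, mul_comm (descentFun t (.some x₁ _ _)), mul_assoc]
      simp [descentFun]
    · simp only [mul_zero] at e₃
      subst e₃
      obtain ⟨c, hc, h⟩ := main h₁ h₂ e₁ e₂ (by linear_combination s₁) (by linear_combination s₂)
      refine ⟨c, hc, ?_⟩
      rw [← h, mul_comm _ (descentFun t (.some 0 _ _))]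
      simp [descentFun]
  · have hne : ∀ {x y : F}, y = ℓ * x + ν → ¬(x = 0 ∧ y = 0) := by
      rintro x y e ⟨rfl, rfl⟩
      exact hν (by linear_combination -e)
    rw [descentFun_some h₁ (hne e₁), descentFun_some h₂ (hne e₂), descentFun_some h₃ (hne e₃)]
    have key : ∀ σ₁ σ₂ σ₃ : F, x₁ + x₂ + x₃ = σ₁ → x₁ * x₂ + x₁ * x₃ + x₂ * x₃ = σ₂ →
        x₁ * x₂ * x₃ = σ₃ →
        ((x₁ + 1) * (ℓ * x₁ + ν) - x₁ ^ 2) * ((x₂ + 1) * (ℓ * x₂ + ν) - x₂ ^ 2) *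
          ((x₃ + 1) * (ℓ * x₃ + ν) - x₃ ^ 2) =
        (ℓ - 1) ^ 3 * σ₃ ^ 2 + (ℓ - 1) ^ 2 * (ℓ + ν) * σ₂ * σ₃ +
          (ℓ - 1) ^ 2 * ν * (σ₂ ^ 2 - 2 * σ₁ * σ₃) + (ℓ - 1) * (ℓ + ν) ^ 2 * σ₁ * σ₃ +
          (ℓ - 1) * (ℓ + ν) * ν * (σ₁ * σ₂ - 3 * σ₃) + (ℓ - 1) * ν ^ 2 * (σ₁ ^ 2 - 2 * σ₂) +
          (ℓ + ν) ^ 3 * σ₃ + (ℓ + ν) ^ 2 * ν * σ₂ + (ℓ + ν) * ν ^ 2 * σ₁ + ν ^ 3 := by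
      rintro _ _ _ rfl rfl rfl
      ring
    rw [e₁, e₂, e₃, key _ _ _ s₁ s₂ s₃]
    exact ⟨ν, hν, by ring⟩

/-- The descent function is a homomorphism modulo fifth powers. -/
theorem descentFun_add [DecidableEq F] {t : F} (ht : t ≠ 0) (A B : (tateCurve t).toAffine.Point) :
    ∃ c : F, c ≠ 0 ∧ descentFun t (A + B) = descentFun t A * descentFun t B * c ^ 5 := by
  rcases A with _ | ⟨x₁, y₁, h₁⟩
  · refine ⟨1, one_ne_zero, ?_⟩
    rw [← Affine.Point.zero_def, zero_add, descentFun_zero]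
    ring
  rcases B with _ | ⟨x₂, y₂, h₂⟩
  · refine ⟨1, one_ne_zero, ?_⟩
    rw [← Affine.Point.zero_def, add_zero, descentFun_zero]
    ring
  by_cases hxy : x₁ = x₂ ∧ y₁ = (tateCurve t).toAffine.negY x₂ y₂
  · rw [Affine.Point.add_of_Y_eq hxy.1 hxy.2, descentFun_zero]
    have : Affine.Point.some x₁ y₁ h₁ = -.some x₂ y₂ h₂ := by
      rw [Affine.Point.neg_some, Affine.Point.some.injEq]
      exact hxy
    rw [this]
    obtain ⟨c, hc, h⟩ := descentFun_neg ht (.some x₂ y₂ h₂)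
    refine ⟨c⁻¹, inv_ne_zero hc, ?_⟩
    rw [h, inv_pow, mul_inv_cancel₀ (pow_ne_zero 5 hc)]
  · obtain ⟨ℓ, ν, x₃, h₃, hadd, e₁, e₂, s₁, s₂, s₃⟩ := exists_line h₁ h₂ hxy
    simp only [tateCurve] at s₁ s₂ s₃
    obtain ⟨c, hc, H⟩ := descentFun_line ht h₁ h₂ h₃ e₁ e₂ rfl (by linear_combination s₁)
      (by linear_combination s₂) (by linear_combination s₃)
    obtain ⟨d, hd, H'⟩ := descentFun_neg ht (.some x₃ _ h₃)
    refine ⟨d / c, div_ne_zero hd hc, ?_⟩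
    have h3 := descentFun_ne_zero ht (.some x₃ _ h₃)
    rw [hadd, div_pow, ← H', ← H]
    have h1 := descentFun_ne_zero ht (.some x₁ _ h₁)
    have h2 := descentFun_ne_zero ht (.some x₂ _ h₂)
    field_simp

theorem descentFun_nsmul [DecidableEq F] {t : F} (ht : t ≠ 0) (A : (tateCurve t).toAffine.Point)
    (n : ℕ) : ∃ c : F, c ≠ 0 ∧ descentFun t (n • A) = descentFun t A ^ n * c ^ 5 := by
  induction n with
  | zero => exact ⟨1, one_ne_zero, by simp [descentFun_zero]⟩
  | succ n ih =>
    obtain ⟨c, hc, h⟩ := ih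
    obtain ⟨d, hd, h'⟩ := descentFun_add ht (n • A) A
    refine ⟨c * d, mul_ne_zero hc hd, ?_⟩
    rw [succ_nsmul, h', h]
    ring

/-- A point of order `5` outside the subgroup generated by `(0, 0)`, that is with `x ≠ 0, t`,
satisfies an equation which makes `5` a square in its field of definition.
The polynomial that is squared on the left is, up to a shift, the numerator of the `x`-coordinate
of the isogeny with kernel generated by `(0, 0)`. -/
theorem five_mul_sq_of_torsion [DecidableEq F] {t x y : F}
    (h : (tateCurve t).toAffine.Nonsingular x y)
    (h5 : 5 • Affine.Point.some x y h = 0) (hx : x ≠ 0) (hxt : x ≠ t) :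
    5 * (2 * (x * (x * (x - t)) ^ 2 + (t ^ 2 - t) * x * (x - t) ^ 2 + t ^ 2 * (x - t) ^ 2 +
        (t ^ 3 + t ^ 2) * (x - t) * x ^ 2 + t ^ 4 * x ^ 2) +
        (t ^ 2 - t + 1) * (x * (x - t)) ^ 2) ^ 2 =
      ((t ^ 2 - 11 * t - 1) * (x * (x - t)) ^ 2) ^ 2 := by
  set R := Affine.Point.some x y h with hR
  have hR0 : R ≠ 0 := Affine.Point.some_ne_zero h
  have hRR : ¬(x = x ∧ y = (tateCurve t).toAffine.negY x y) := by
    rintro ⟨-, hy⟩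
    have h2 : R + R = 0 := Affine.Point.add_self_of_Y_eq hy
    apply hR0
    have : 5 • R = (R + R) + (R + R) + R := by abel
    rwa [h5, h2, zero_add, zero_add, eq_comm] at this
  obtain ⟨ℓ, ν, x₂, h₂, hadd, e₁, -, s₁, s₂, s₃⟩ := exists_line h h hRR
  rw [← hR] at hadd
  set S := Affine.Point.some x₂ _ h₂ with hS
  have hSR : S = -(R + R) := by rw [hadd, neg_neg]
  have hSS : S + S = R := by
    have : S + S - R = -(5 • R) := by rw [hSR]; abel
    rwa [h5, neg_zero, sub_eq_zero] at this
  have hSS' : ¬(x₂ = x₂ ∧ ℓ * x₂ + ν = (tateCurve t).toAffine.negY x₂ (ℓ * x₂ + ν)) := by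
    rintro ⟨-, hy⟩
    have h2 : S + S = 0 := Affine.Point.add_self_of_Y_eq hy
    exact hR0 (hSS ▸ h2)
  obtain ⟨ℓ', ν', x₃, h₃, hadd', e₁', -, s₁', -, -⟩ := exists_line h₂ h₂ hSS'
  rw [← hS, hSS, hR, eq_neg_iff_add_eq_zero, add_comm, ← eq_neg_iff_add_eq_zero,
    Affine.Point.neg_some, Affine.Point.some.injEq] at hadd'
  obtain ⟨rfl, hy3⟩ := hadd'
  have he := tateCurve_equation.1 h.1
  have hyy : y ≠ (tateCurve t).toAffine.negY x₃ y := fun H => hRR ⟨rfl, H⟩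
  simp only [tateCurve, Affine.negY] at s₁ s₂ s₁' hy3 hyy
  clear_value R S
  set p := 2 * y + (1 - t) * x₃ - t with hp
  have hp0 : p ≠ 0 := fun H => hyy (by linear_combination H)
  -- the tangent at `R` has slope `ℓ`, and `x₂ = x(2R)`
  have hN : ℓ * p = 3 * x₃ ^ 2 - 2 * t * x₃ - (1 - t) * y := by
    rw [hp]
    linear_combination s₂ - 2 * x₃ * s₁ + (2 * ℓ + (1 - t)) * e₁
  have hS2 : p ^ 2 = 4 * x₃ ^ 3 + (t ^ 2 - 6 * t + 1) * x₃ ^ 2 + 2 * (t ^ 2 - t) * x₃ + t ^ 2 := by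
    rw [hp]
    linear_combination 4 * he
  have hψ : (x₃ - x₂) * p ^ 2 = 3 * x₃ ^ 4 + (t ^ 2 - 6 * t + 1) * x₃ ^ 3 +
      3 * (t ^ 2 - t) * x₃ ^ 2 + 3 * t ^ 2 * x₃ - t ^ 3 := by
    linear_combination -p ^ 2 * s₁ - (ℓ * p + (3 * x₃ ^ 2 - 2 * t * x₃ - (1 - t) * y) +
      (1 - t) * p) * hN + (12 * x₃ + (t ^ 2 - 6 * t + 1)) * he
  -- the tangent at `-2R` has slope `ℓ'` and meets the curve again at `-R`
  have hk : (x₃ - x₂) * ℓ' = -p + ℓ * (x₃ - x₂) := by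
    rw [hp]
    linear_combination hy3 + e₁' + e₁
  have h1 : (3 * x₃ - 2 * (x₃ - x₂)) * (x₃ - x₂) ^ 2 = (-p + ℓ * (x₃ - x₂)) ^ 2 +
      (1 - t) * (-p + ℓ * (x₃ - x₂)) * (x₃ - x₂) + t * (x₃ - x₂) ^ 2 := by
    rw [← hk]
    linear_combination (x₃ - x₂) ^ 2 * s₁'
  have h2 : ((x₃ - x₂) * p ^ 2) ^ 3 + p ^ 8 - p ^ 4 * ((x₃ - x₂) * p ^ 2) *
      (2 * (ℓ * p) + (1 - t) * p) = 0 := by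
    linear_combination -p ^ 6 * h1 + p ^ 6 * (x₃ - x₂) ^ 2 * s₁
  have h3 : 2 * (ℓ * p) + (1 - t) * p = 6 * x₃ ^ 2 + (t ^ 2 - 6 * t + 1) * x₃ + (t ^ 2 - t) := by
    rw [hN, hp]
    ring
  rw [h3, show p ^ 8 = (p ^ 2) ^ 4 by ring, show p ^ 4 = (p ^ 2) ^ 2 by ring, hψ, hS2] at h2
  refine mul_left_cancel₀ (mul_ne_zero hx (sub_ne_zero.2 hxt)) ?_
  linear_combination -4 * h2

end TateCurve

/-! ### Surjectivity of isogenies on geometric points -/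

section Surjective

open Polynomial

variable {K : Type*} [Field K]

/-- The solutions of a nonzero quadratic equation form a finite set. -/
theorem finite_quadratic {α β γ : K} (h : ¬(α = 0 ∧ β = 0 ∧ γ = 0)) :
    {c : K | α + c * β + c ^ 2 * γ = 0}.Finite := by
  have hp : (C α + X * C β + X ^ 2 * C γ : K[X]) ≠ 0 := by
    intro H
    apply h
    have h0 := congrArg (fun p => coeff p 0) H
    have h1 := congrArg (fun p => coeff p 1) H
    have h2 := congrArg (fun p => coeff p 2) H
    simp [coeff_X_pow, coeff_C, coeff_X] at h0 h1 h2
    exact ⟨h0, h1, h2⟩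
  refine (finite_setOfPred_isRoot hp).subset fun c hc => ?_
  have hc : α + c * β + c ^ 2 * γ = 0 := hc
  simp only [Set.mem_ofPred_eq, IsRoot, eval_add, eval_mul, eval_pow, eval_C, eval_X]
  exact hc

/-- Either a quadratic pencil of polynomials `p + c q + c² r` is a multiple of a fixed polynomial,
or almost all of its members have a zero outside any given finite set. -/
theorem pencil_dichotomy [IsAlgClosed K] (p q r : K[X]) (hr : r ≠ 0) {B : Set K} (hB : B.Finite) :
    (∃ (G : K[X]) (α β γ : K), p = C α * G ∧ q = C β * G ∧ r = C γ * G) ∨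
      {c : K | ∀ x ∉ B, p.eval x + c * q.eval x + c ^ 2 * r.eval x ≠ 0}.Finite := by
  obtain ⟨G, hG⟩ := (IsPrincipalIdealRing.principal (Ideal.span ({p, q, r} : Set K[X]))).principal
  have hp : p ∈ Ideal.span ({p, q, r} : Set K[X]) := Ideal.subset_span (by simp)
  have hq : q ∈ Ideal.span ({p, q, r} : Set K[X]) := Ideal.subset_span (by simp)
  have hr' : r ∈ Ideal.span ({p, q, r} : Set K[X]) := Ideal.subset_span (by simp)
  have hGm : G ∈ Ideal.span ({p, q, r} : Set K[X]) := by
    rw [hG]; exact Submodule.mem_span_singleton_self G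
  rw [hG] at hp hq hr'
  obtain ⟨p', rfl⟩ := Submodule.mem_span_singleton.1 hp
  obtain ⟨q', rfl⟩ := Submodule.mem_span_singleton.1 hq
  obtain ⟨r', rfl⟩ := Submodule.mem_span_singleton.1 hr'
  simp only [smul_eq_mul] at *
  have hG0 : G ≠ 0 := right_ne_zero_of_mul hr
  obtain ⟨u, v, w, huvw⟩ : ∃ u v w : K[X], u * p' + v * q' + w * r' = 1 := by
    rw [Ideal.mem_span_insert] at hGm
    obtain ⟨u, z, hz, e⟩ := hGm
    obtain ⟨v, w, rfl⟩ := Ideal.mem_span_pair.1 hz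
    exact ⟨u, v, w, mul_right_cancel₀ hG0 (by linear_combination -e)⟩
  by_cases hconst : ∀ m, 1 ≤ m → p'.coeff m = 0 ∧ q'.coeff m = 0 ∧ r'.coeff m = 0
  · left
    have hC : ∀ s : K[X], (∀ m, 1 ≤ m → s.coeff m = 0) → s = C (s.coeff 0) := by
      intro s hs
      ext m
      rcases Nat.eq_zero_or_pos m with rfl | hm
      · simp
      · rw [hs m hm, coeff_C_of_ne_zero hm.ne']
    refine ⟨G, p'.coeff 0, q'.coeff 0, r'.coeff 0, ?_, ?_, ?_⟩
    · rw [← hC p' fun m hm => (hconst m hm).1]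
    · rw [← hC q' fun m hm => (hconst m hm).2.1]
    · rw [← hC r' fun m hm => (hconst m hm).2.2]
  · right
    push Not at hconst
    obtain ⟨m, hm, hne⟩ := hconst
    have hfin1 : {c : K | p'.coeff m + c * q'.coeff m + c ^ 2 * r'.coeff m = 0}.Finite :=
      finite_quadratic fun h => hne h.1 h.2.1 h.2.2
    have hfin2 : (⋃ b ∈ B, {c : K | p'.eval b + c * q'.eval b + c ^ 2 * r'.eval b = 0}).Finite := by
      refine hB.biUnion fun b _ => finite_quadratic ?_
      rintro ⟨h1, h2, h3⟩
      have := congrArg (eval b) huvw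
      simp [h1, h2, h3] at this
    refine (hfin1.union hfin2).subset fun c hc => ?_
    by_contra hcon
    simp only [Set.mem_union, Set.mem_ofPred_eq, Set.mem_iUnion, not_or, not_exists] at hcon
    obtain ⟨hc1, hc2⟩ := hcon
    have hdeg : (p' + C c * q' + C (c ^ 2) * r').degree ≠ 0 := by
      intro hd
      apply hc1
      have := coeff_eq_zero_of_degree_lt (p := p' + C c * q' + C (c ^ 2) * r') (n := m)
        (by rw [hd]; exact_mod_cast hm)
      rwa [coeff_add, coeff_add, coeff_C_mul, coeff_C_mul] at this
    obtain ⟨x, hx⟩ := IsAlgClosed.exists_root _ hdeg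
    simp only [IsRoot, eval_add, eval_mul, eval_C] at hx
    refine hc x (fun hxB => hc2 x hxB hx) ?_
    simp only [eval_mul]
    linear_combination eval x G * hx

variable (W : WeierstrassCurve K)

/-- The norm to `K[X]` of the function `a + b Y` on a Weierstrass curve. -/
noncomputable def normPoly (a b : K[X]) : K[X] :=
  a ^ 2 - a * b * (C W.a₁ * X + C W.a₃) - b ^ 2 * (X ^ 3 + C W.a₂ * X ^ 2 + C W.a₄ * X + C W.a₆)

theorem eval_normPoly {W : WeierstrassCurve K} (a b : K[X]) {x y : K}
    (h : W.toAffine.Equation x y) : (normPoly W a b).eval x =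
      (a.eval x + b.eval x * y) * (a.eval x + b.eval x * W.toAffine.negY x y) := by
  rw [Affine.equation_iff] at h
  simp only [normPoly, Affine.negY, eval_sub, eval_add, eval_mul, eval_pow, eval_C, eval_X]
  linear_combination (b.eval x) ^ 2 * h

theorem normPoly_ne_zero [CharZero K] {W : WeierstrassCurve K} {a b : K[X]}
    (h : ¬(a = 0 ∧ b = 0)) : normPoly W a b ≠ 0 := by
  intro H
  have hb : b ≠ 0 := by
    rintro rfl
    simp [normPoly] at H
    exact h ⟨H, rfl⟩
  set S : K[X] := C 4 * X ^ 3 + C (W.a₁ ^ 2 + 4 * W.a₂) * X ^ 2 +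
    C (2 * W.a₁ * W.a₃ + 4 * W.a₄) * X + C (W.a₃ ^ 2 + 4 * W.a₆) with hS
  have hSd : S.natDegree = 3 := natDegree_cubic (by norm_num)
  have hS0 : S ≠ 0 := by
    rintro h0
    rw [h0] at hSd
    simp at hSd
  have e : (2 * a - b * (C W.a₁ * X + C W.a₃)) ^ 2 = b ^ 2 * S := by
    rw [normPoly] at H
    simp only [hS, C_add, C_mul, C_pow, map_ofNat]
    linear_combination 4 * H
  have := congrArg natDegree e
  rw [natDegree_pow, natDegree_mul (pow_ne_zero 2 hb) hS0, natDegree_pow, hSd] at this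
  omega

theorem exists_equation [IsAlgClosed K] (x : K) : ∃ y, W.toAffine.Equation x y := by
  obtain ⟨y, hy⟩ := IsAlgClosed.exists_root (C 1 * X ^ 2 + C (W.a₁ * x + W.a₃) * X +
    C (-(x ^ 3 + W.a₂ * x ^ 2 + W.a₄ * x + W.a₆)) : K[X])
    (by rw [degree_quadratic one_ne_zero]; decide)
  refine ⟨y, ?_⟩
  rw [Affine.equation_iff]
  simp only [IsRoot, eval_add, eval_mul, eval_pow, eval_C, eval_X] at hy
  linear_combination hy

theorem infinite_point [IsAlgClosed K] [W.IsElliptic] : Infinite W.toAffine.Point := by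
  have : Infinite K := IsAlgClosed.instInfinite
  choose f hf using exists_equation W
  refine Infinite.of_injective (fun x => Affine.Point.mk (hf x)) fun x x' h => ?_
  simpa [Affine.Point.mk] using And.left (by simpa [Affine.Point.mk] using h)

theorem finite_xRep (Z : Set K) (hZ : Z.Finite) :
    {P : W.toAffine.Point | P.xRep ∈ (fun z => ![z, 1]) '' Z}.Finite := by
  refine (hZ.image fun z : K => ![z, 1]).preimage' fun b _ => ?_
  by_cases hb : ∃ Q : W.toAffine.Point, Q.xRep = b
  · obtain ⟨Q, rfl⟩ := hb
    refine (Set.toFinite {Q, -Q}).subset fun P hP => ?_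
    exact Affine.Point.eq_or_eq_neg_of_xRep_eq_xRep hP
  · convert Set.finite_empty
    ext P
    simpa using fun h => hb ⟨P, h⟩

theorem finite_zeros [CharZero K] {a b : K[X]} (h : ¬(a = 0 ∧ b = 0)) :
    {P : W.toAffine.Point | ∃ x y h, P = .some x y h ∧ a.eval x + b.eval x * y = 0}.Finite := by
  refine (finite_xRep W {x | (normPoly W a b).IsRoot x}
    (finite_setOfPred_isRoot (normPoly_ne_zero h))).subset ?_
  rintro _ ⟨x, y, hxy, rfl, h0⟩
  refine ⟨x, ?_, by simp⟩
  simp [IsRoot, eval_normPoly a b hxy.1, h0]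

/-- A subgroup with finite complement of an infinite group is everything. -/
theorem addSubgroup_eq_top_of_finite_compl {G : Type*} [AddCommGroup G] [Infinite G]
    (H : AddSubgroup G) (h : {x | x ∉ H}.Finite) : H = ⊤ := by
  rw [AddSubgroup.eq_top_iff']
  intro x
  have h2 : {y | x - y ∉ H}.Finite := h.preimage (f := fun y => x - y) sub_right_injective.injOn
  obtain ⟨y, hy⟩ := (h.union h2).infinite_compl.nonempty
  simp only [Set.mem_compl_iff, Set.mem_union, Set.mem_ofPred_eq, not_or, not_not] at hy
  simpa using H.add_mem hy.2 hy.1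

variable {W}

open scoped Classical in
/-- A homomorphism with finite kernel between the groups of points of two Weierstrass curves over
an algebraically closed field is surjective, provided that it is given by a rational function on
the `x`-coordinates outside the zeros of the denominator.  A point with first coordinate `c` is hit
up to sign when the norm to `K[X]` of numerator minus `c` times denominator has a zero outside a
finite set; these norms form a quadratic pencil, and so this fails for finitely many `c` only. The
image is then a subgroup with finite complement. -/
theorem surjective_of_rational [CharZero K] [IsAlgClosed K] [W.IsElliptic]
    {W' : WeierstrassCurve K} (φ : W.toAffine.Point →+ W'.toAffine.Point)
    (hker : (φ.ker : Set W.toAffine.Point).Finite) {a b a' b' : K[X]} (hd : ¬(a' = 0 ∧ b' = 0))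
    (hφ : ∀ x y (h : W.toAffine.Nonsingular x y), a'.eval x + b'.eval x * y ≠ 0 →
      ∃ y' h', φ (.some x y h) =
        .some ((a.eval x + b.eval x * y) / (a'.eval x + b'.eval x * y)) y' h') :
    Function.Surjective φ := by
  have hinf : Infinite W.toAffine.Point := infinite_point W
  have hfib : ∀ Q, (φ ⁻¹' {Q}).Finite := by
    intro Q
    by_cases hQ : ∃ P, φ P = Q
    · obtain ⟨P, rfl⟩ := hQ
      refine (hker.image fun A => A + P).subset fun A hA => ⟨A - P, ?_, by simp⟩
      have hA : φ A = φ P := hA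
      simp [AddMonoidHom.mem_ker, hA]
    · convert Set.finite_empty
      ext P
      simpa using fun h => hQ ⟨P, h⟩
  have hinf' : Infinite W'.toAffine.Point := by
    by_contra hcon
    rw [not_infinite_iff_finite] at hcon
    have : (φ ⁻¹' Set.univ).Finite := Set.finite_univ.preimage' fun b _ => hfib b
    exact Set.infinite_univ (by simpa using this)
  set N := normPoly W a' b' with hN
  have hN0 : N ≠ 0 := normPoly_ne_zero hd
  set B : Set K := {x | N.IsRoot x} with hBdef
  have hB : B.Finite := finite_setOfPred_isRoot hN0
  have hdne : ∀ x y, W.toAffine.Equation x y → x ∉ B → a'.eval x + b'.eval x * y ≠ 0 := by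
    intro x y hxy hx h0
    apply hx
    simp [hBdef, hN, IsRoot, eval_normPoly a' b' hxy, h0]
  -- the norm of `(a + b Y) - c (a' + b' Y)` as a quadratic polynomial in `c`
  set q : K[X] := -(2 * a * a') + (a * b' + a' * b) * (C W.a₁ * X + C W.a₃) +
    2 * b * b' * (X ^ 3 + C W.a₂ * X ^ 2 + C W.a₄ * X + C W.a₆) with hq
  have hpencil : ∀ c : K, normPoly W (a - C c * a') (b - C c * b') =
      normPoly W a b + C c * q + C (c ^ 2) * N := by
    intro c
    simp only [normPoly, hq, hN, C_pow]
    ring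
  have hpencil' : ∀ c x y, W.toAffine.Equation x y →
      (normPoly W a b).eval x + c * q.eval x + c ^ 2 * N.eval x =
      (a.eval x + b.eval x * y - c * (a'.eval x + b'.eval x * y)) *
      (a.eval x + b.eval x * W.toAffine.negY x y -
        c * (a'.eval x + b'.eval x * W.toAffine.negY x y)) := by
    intro c x y hxy
    have := eval_normPoly (a - C c * a') (b - C c * b') hxy
    rw [hpencil] at this
    simp only [eval_add, eval_mul, eval_C, eval_sub] at this
    rw [this]
    ring
  rcases pencil_dichotomy (normPoly W a b) q N hN0 hB with ⟨G, α, β, γ, e1, e2, e3⟩ | hfin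
  · -- then the `x`-coordinate takes finitely many values on the image
    exfalso
    have hγ : γ ≠ 0 := by
      rintro rfl
      exact hN0 (by simpa using e3)
    have hZ : {c : K | α + c * β + c ^ 2 * γ = 0}.Finite := finite_quadratic fun h => hγ h.2.2
    have hV := finite_xRep W' _ hZ
    have hU := hV.preimage' (f := φ) fun Q _ => hfib Q
    have hU2 := finite_xRep W B hB
    refine Set.infinite_univ (((hU.union hU2).union (Set.finite_singleton 0)).subset ?_)
    rintro (_ | ⟨x, y, hxy⟩) -
    · right; rfl
    · left
      by_cases hx : x ∈ B
      · right
        exact ⟨x, hx, rfl⟩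
      · left
        have hd0 := hdne x y hxy.1 hx
        obtain ⟨y', h', e⟩ := hφ x y hxy hd0
        have hG : G.eval x ≠ 0 := by
          intro h0
          apply hx
          simp [hBdef, IsRoot, e3, h0]
        refine ⟨(a.eval x + b.eval x * y) / (a'.eval x + b'.eval x * y), ?_, ?_⟩
        · have := hpencil' ((a.eval x + b.eval x * y) / (a'.eval x + b'.eval x * y)) x y hxy.1
          rw [div_mul_cancel₀ _ hd0, sub_self, zero_mul, e1, e2, e3] at this
          simp only [eval_mul, eval_C] at this
          refine mul_left_cancel₀ hG ?_
          linear_combination this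
        · rw [e, Affine.Point.xRep_some]
  · -- all but finitely many points are in the image
    have hbad := finite_xRep W' _ hfin
    have hcompl : {Q | Q ∉ φ.range}.Finite := by
      refine hbad.subset ?_
      rintro (_ | ⟨c, y₀, hc⟩) hQ
      · exact absurd (zero_mem φ.range) hQ
      · refine ⟨c, ?_, rfl⟩
        intro x hx h0
        apply hQ
        obtain ⟨y₁, hy₁⟩ := exists_equation W x
        rw [hpencil' c x y₁ hy₁] at h0
        obtain ⟨y, hy, hz⟩ : ∃ y, W.toAffine.Equation x y ∧
            a.eval x + b.eval x * y - c * (a'.eval x + b'.eval x * y) = 0 := by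
          rcases mul_eq_zero.1 h0 with h | h
          · exact ⟨y₁, hy₁, h⟩
          · exact ⟨_, (Affine.equation_neg ..).2 hy₁, h⟩
        have hd0 := hdne x y hy hx
        obtain ⟨y', h', e⟩ := hφ x y (Affine.equation_iff_nonsingular.1 hy) hd0
        have hcx : (a.eval x + b.eval x * y) / (a'.eval x + b'.eval x * y) = c := by
          rw [div_eq_iff hd0]
          linear_combination hz
        have hx2 : (φ (.some x y (Affine.equation_iff_nonsingular.1 hy))).xRep =
            (Affine.Point.some c y₀ hc).xRep := by
          rw [e, Affine.Point.xRep_some, Affine.Point.xRep_some, hcx]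
        rcases Affine.Point.eq_or_eq_neg_of_xRep_eq_xRep hx2 with h | h
        · exact ⟨_, h⟩
        · rw [← neg_neg (Affine.Point.some c y₀ hc), ← h]
          exact neg_mem ⟨_, rfl⟩
    have := addSubgroup_eq_top_of_finite_compl φ.range hcompl
    exact AddMonoidHom.range_eq_top.1 this

end Surjective

/-! ### Galois equivariance of isogenies -/

section Isogeny

open Polynomial

local notation "ℚbar" => AlgebraicClosure ℚ

/-- On a Weierstrass curve every polynomial function has the form `a(x) + b(x) y`. -/
theorem exists_aevalAeval_eq (W : WeierstrassCurve ℚ) (p : ℚ[X][Y]) : ∃ a b : ℚ[X],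
    ∀ x y : ℚbar, (W.baseChange ℚbar).toAffine.Equation x y →
      aevalAeval x y p = aeval x a + aeval x b * y := by
  induction p using Polynomial.induction_on with
  | C c => exact ⟨c, 0, fun x y _ => by simp⟩
  | add p q hp hq =>
    obtain ⟨a, b, h⟩ := hp
    obtain ⟨a', b', h'⟩ := hq
    refine ⟨a + a', b + b', fun x y hxy => ?_⟩
    rw [map_add, h x y hxy, h' x y hxy, map_add, map_add]
    ring
  | monomial n c ih =>
    obtain ⟨a, b, h⟩ := ih
    refine ⟨b * (X ^ 3 + C W.a₂ * X ^ 2 + C W.a₄ * X + C W.a₆),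
      a - b * (C W.a₁ * X + C W.a₃), fun x y hxy => ?_⟩
    rw [pow_succ, ← mul_assoc, map_mul, h x y hxy]
    rw [Affine.equation_iff] at hxy
    simp only [WeierstrassCurve.baseChange, map_a₁, map_a₂, map_a₃, map_a₄, map_a₆] at hxy
    simp only [map_mul, map_add, map_sub, map_pow, aeval_X, aeval_C]
    rw [aevalAeval_Y]
    linear_combination (aeval x b) * hxy

variable {W W' : WeierstrassCurve ℚ}

/-- Normal form of the first coordinate of an isogeny, and its second coordinate. -/
theorem Isogeny.exists_normal (φ : Isogeny W W') : ∃ a b a₁ b₁ a' b' : ℚ[X],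
    ¬(a' = 0 ∧ b' = 0) ∧ ∀ x y (h : (W.baseChange ℚbar).toAffine.Nonsingular x y),
      aeval x a' + aeval x b' * y ≠ 0 →
      ∃ h', φ.toHom (.some x y h) =
        .some ((aeval x a + aeval x b * y) / (aeval x a' + aeval x b' * y))
          ((aeval x a₁ + aeval x b₁ * y) / (aeval x a' + aeval x b' * y)) h' := by
  obtain ⟨f, g, d, ⟨x₀, y₀, h₀, hd⟩, H⟩ := φ.rational
  obtain ⟨a, b, hf⟩ := exists_aevalAeval_eq W f
  obtain ⟨a₁, b₁, hg⟩ := exists_aevalAeval_eq W g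
  obtain ⟨a', b', hd'⟩ := exists_aevalAeval_eq W d
  refine ⟨a, b, a₁, b₁, a', b', ?_, ?_⟩
  · rintro ⟨rfl, rfl⟩
    rw [hd' _ _ h₀.1] at hd
    simp at hd
  · intro x y h hne
    rw [← hd' _ _ h.1] at hne ⊢
    rw [← hf _ _ h.1, ← hg _ _ h.1]
    exact H x y h hne

instance [W.IsElliptic] : (W.baseChange ℚbar).IsElliptic :=
  inferInstanceAs (W.map (algebraMap ℚ ℚbar)).IsElliptic

open scoped Classical in
theorem Isogeny.surjective [W.IsElliptic] (φ : Isogeny W W')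
    (hker : (φ.toHom.ker : Set (W.baseChange ℚbar).toAffine.Point).Finite) :
    Function.Surjective φ.toHom := by
  obtain ⟨a, b, a₁, b₁, a', b', hne, H⟩ := φ.exists_normal
  have hinj := (algebraMap ℚ ℚbar).injective
  refine surjective_of_rational φ.toHom hker (a := a.map (algebraMap ℚ ℚbar))
    (b := b.map (algebraMap ℚ ℚbar)) (a' := a'.map (algebraMap ℚ ℚbar))
    (b' := b'.map (algebraMap ℚ ℚbar)) ?_ ?_
  · simpa [Polynomial.map_eq_zero_iff hinj] using hne
  · intro x y h h0
    simp only [eval_map_algebraMap] at h0 ⊢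
    obtain ⟨h', e⟩ := H x y h h0
    exact ⟨_, h', e⟩

open scoped Classical in
/-- An isogeny over `ℚ` commutes with the Galois action: this is clear where the rational
functions defining it have nonzero denominator, and every point is a difference of such points. -/
theorem Isogeny.map_galois [W.IsElliptic] (φ : Isogeny W W') (σ : ℚbar →ₐ[ℚ] ℚbar)
    (A : (W.baseChange ℚbar).toAffine.Point) :
    φ.toHom (Affine.Point.map (W' := W.toAffine) σ A) =
      Affine.Point.map (W' := W'.toAffine) σ (φ.toHom A) := by
  obtain ⟨a, b, a₁, b₁, a', b', hne, H⟩ := φ.exists_normal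
  have hinj := (algebraMap ℚ ℚbar).injective
  have hinf : Infinite (W.baseChange ℚbar).toAffine.Point := infinite_point _
  have hfin := finite_zeros (W.baseChange ℚbar) (a := a'.map (algebraMap ℚ ℚbar))
    (b := b'.map (algebraMap ℚ ℚbar)) (by simpa [Polynomial.map_eq_zero_iff hinj] using hne)
  simp only [eval_map_algebraMap] at hfin
  have good : ∀ A : (W.baseChange ℚbar).toAffine.Point, (A ≠ 0 ∧ ¬∃ x y h, A = .some x y h ∧
      aeval x a' + aeval x b' * y = 0) → φ.toHom (Affine.Point.map (W' := W.toAffine) σ A) =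
        Affine.Point.map (W' := W'.toAffine) σ (φ.toHom A) := by
    rintro (_ | ⟨x, y, h⟩) ⟨hA0, hA⟩
    · exact absurd rfl hA0
    have hd : aeval x a' + aeval x b' * y ≠ 0 := fun h0 => hA ⟨x, y, h, rfl, h0⟩
    have hσ : ∀ a b : ℚ[X], aeval (σ x) a + aeval (σ x) b * σ y =
        σ (aeval x a + aeval x b * y) := by
      intro a b
      rw [map_add, map_mul, aeval_algHom_apply, aeval_algHom_apply]
    obtain ⟨h1, e1⟩ := H x y h hd
    rw [e1, Affine.Point.map_some, Affine.Point.map_some]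
    obtain ⟨h2, e2⟩ := H (σ x) (σ y)
      ((W.toAffine.baseChange_nonsingular σ.injective ..).mpr h)
      (by rw [hσ]; exact (map_ne_zero σ).2 hd)
    rw [e2, Affine.Point.some.injEq]
    simp only [hσ, map_div₀, and_self]
  have h1 := (hfin.union (Set.finite_singleton 0))
  have h2 := h1.preimage (f := fun B => B - A) sub_left_injective.injOn
  obtain ⟨B, hB⟩ := (h1.union h2).infinite_compl.nonempty
  simp only [Set.mem_compl_iff, Set.mem_union, Set.mem_preimage, Set.mem_singleton_iff,
    Set.mem_ofPred_eq, not_or] at hB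
  have e : A = B - (B - A) := by abel
  have e' : Affine.Point.map (W' := W.toAffine) σ A = Affine.Point.map (W' := W.toAffine) σ B -
      Affine.Point.map (W' := W.toAffine) σ (B - A) := by
    rw [← map_sub, ← e]
  rw [e', map_sub, good B ⟨hB.1.2, hB.1.1⟩, good (B - A) ⟨hB.2.2, hB.2.1⟩, ← map_sub, ← map_sub,
    ← e]

open scoped Classical in
/-- If the quotient of `W` by a rational point `P` of order `5` has a rational point `Q` of order
`5`, then a geometric preimage `R` of `Q` is Galois invariant modulo `⟨P⟩`. -/
theorem exists_galois_invariant_mod [W.IsElliptic] {P : (W.baseChange ℚ).toAffine.Point}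
    (hP : addOrderOf P = 5) (hW' : IsQuotientBy W P W') {Q : (W'.baseChange ℚ).toAffine.Point}
    (hQ : addOrderOf Q = 5) : ∃ R : (W.baseChange ℚbar).toAffine.Point,
      R ∉ AddSubgroup.zmultiples (Affine.Point.baseChange ℚ ℚbar P) ∧
      5 • R ∈ AddSubgroup.zmultiples (Affine.Point.baseChange ℚ ℚbar P) ∧
      ∀ σ : ℚbar →ₐ[ℚ] ℚbar, Affine.Point.map (W' := W.toAffine) σ R - R ∈
        AddSubgroup.zmultiples (Affine.Point.baseChange ℚ ℚbar P) := by
  obtain ⟨φ, hφ⟩ := hW'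
  have hfin : (φ.toHom.ker : Set (W.baseChange ℚbar).toAffine.Point).Finite := by
    rw [hφ, finite_zmultiples]
    exact (Affine.Point.baseChange ℚ ℚbar).isOfFinAddOrder
      (addOrderOf_pos_iff.1 (by rw [hP]; norm_num))
  obtain ⟨R, hR⟩ := φ.surjective hfin (Affine.Point.baseChange ℚ ℚbar Q)
  refine ⟨R, ?_, ?_, ?_⟩
  · rw [← hφ, AddMonoidHom.mem_ker, hR, ← map_zero (Affine.Point.baseChange ℚ ℚbar)]
    intro h
    rw [Affine.Point.map_injective _ h, addOrderOf_zero] at hQ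
    norm_num at hQ
  · rw [← hφ, AddMonoidHom.mem_ker, map_nsmul, hR, ← map_nsmul, ← hQ, addOrderOf_nsmul_eq_zero,
      map_zero]
  · intro σ
    rw [← hφ, AddMonoidHom.mem_ker, map_sub, φ.map_galois, hR, sub_eq_zero]
    exact Affine.Point.map_baseChange σ Q

end Isogeny

/-! ### Elements of `ℚ̄` fixed by all fifth powers of the Galois group -/

section FixedByFifthPowers

local notation "ℚbar" => AlgebraicClosure ℚ

/-- The subfield of `ℚ̄` fixed by the fifth powers of all Galois automorphisms.  It contains the
field of definition of every point which is Galois invariant modulo a rational subgroup of order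
`5`. -/
def quinticField : IntermediateField ℚ ℚbar where
  carrier := {z | ∀ σ : ℚbar ≃ₐ[ℚ] ℚbar, σ (σ (σ (σ (σ z)))) = z}
  mul_mem' ha hb σ := by simp only [map_mul, ha σ, hb σ]
  add_mem' ha hb σ := by simp only [map_add, ha σ, hb σ]
  algebraMap_mem' r σ := by simp
  inv_mem' a ha σ := by simp only [map_inv₀, ha σ]

theorem exists_rat_of_fixed {z : ℚbar} (hz : ∀ σ : ℚbar ≃ₐ[ℚ] ℚbar, σ z = z) :
    ∃ r : ℚ, algebraMap ℚ ℚbar r = z := by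
  -- the `ℚ`-algebra structure in use is the one of division rings of characteristic zero
  have h : @IsAlgClosure ℚ ℚbar _ _ (AlgebraicClosure.instAlgebra ℚ) _ :=
    inferInstance
  have : IsAlgClosure ℚ ℚbar := by convert h; exact Subsingleton.elim _ _
  have : IsGalois ℚ ℚbar := IsAlgClosure.isGalois ℚ ℚbar
  exact (InfiniteGalois.mem_range_algebraMap_iff_fixed z).2 hz

/-- The square root of `5` is not fixed by the fifth power of an automorphism `σ` changing its sign,
because `5` is odd. -/
theorem sq_ne_five_of_mem_quinticField {z : ℚbar} (hz : z ∈ quinticField) : z ^ 2 ≠ 5 := by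
  intro h
  by_cases hfix : ∀ σ : ℚbar ≃ₐ[ℚ] ℚbar, σ z = z
  · obtain ⟨r, rfl⟩ := exists_rat_of_fixed hfix
    have h5 : r ^ 2 = 5 := by
      apply (algebraMap ℚ ℚbar).injective
      rw [map_pow, h, map_ofNat]
    have hirr : Irrational (Real.sqrt (5 : ℕ)) := Nat.Prime.irrational_sqrt (by norm_num)
    apply hirr
    refine ⟨|r|, ?_⟩
    have : (5 : ℕ) = ((r : ℝ)) ^ 2 := by exact_mod_cast h5.symm
    rw [this, Real.sqrt_sq_eq_abs]
    simp
  · push Not at hfix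
    obtain ⟨σ, hσ⟩ := hfix
    have h2 : σ z = -z := by
      have : (σ z - z) * (σ z + z) = 0 := by
        have h' : (σ z) ^ 2 = 5 := by rw [← map_pow, h, map_ofNat]
        linear_combination h' - h
      rcases mul_eq_zero.1 this with h | h
      · exact absurd (sub_eq_zero.1 h) hσ
      · exact eq_neg_of_add_eq_zero_left h
    have h5 := hz σ
    simp only [h2, map_neg, neg_neg] at h5
    exact hσ (h2.trans h5)

/-- A rational number which is a fifth power in `quinticField` is a fifth power: otherwise this
field would contain a primitive fifth root of unity `ζ`, and so `√5 = 2(ζ + ζ⁴) + 1`. -/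
theorem exists_pow_five_of_quinticField {q : ℚ} {z : ℚbar} (hz : z ∈ quinticField)
    (h : z ^ 5 = algebraMap ℚ ℚbar q) : ∃ r : ℚ, q = r ^ 5 := by
  by_cases hz0 : z = 0
  · refine ⟨0, ?_⟩
    rw [hz0] at h
    simpa using h.symm
  by_cases hfix : ∀ σ : ℚbar ≃ₐ[ℚ] ℚbar, σ z = z
  · obtain ⟨r, rfl⟩ := exists_rat_of_fixed hfix
    exact ⟨r, (algebraMap ℚ ℚbar).injective (by rw [← h, map_pow])⟩
  · exfalso
    push Not at hfix
    obtain ⟨σ, hσ⟩ := hfix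
    have hσz : σ z ∈ quinticField := by
      intro τ
      have := congrArg σ (hz ((σ.trans τ).trans σ.symm))
      simpa using this
    have hζ : σ z / z ∈ quinticField := quinticField.div_mem hσz hz
    set ζ := σ z / z with hζdef
    have hζ1 : ζ - 1 ≠ 0 := by
      intro h1
      apply hσ
      rw [sub_eq_zero, hζdef, div_eq_one_iff_eq hz0] at h1
      exact h1
    have hζ5 : ζ ^ 5 = 1 := by
      rw [hζdef, div_pow, ← map_pow, h, AlgEquiv.commutes, div_self]
      rw [← h]
      exact pow_ne_zero 5 hz0
    have hsum : 1 + ζ + ζ ^ 2 + ζ ^ 3 + ζ ^ 4 = 0 := by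
      refine mul_left_cancel₀ hζ1 ?_
      linear_combination hζ5
    refine sq_ne_five_of_mem_quinticField (z := 2 * (ζ + ζ ^ 4) + 1) ?_ ?_
    · exact add_mem (mul_mem (ofNat_mem _ 2) (add_mem hζ (pow_mem hζ 4))) (one_mem _)
    · linear_combination (4 * ζ ^ 3 + 8) * hζ5 + 4 * hsum

end FixedByFifthPowers

/-! ### Existence of the Tate normal form -/

section TateNormalForm

variable {F : Type*} [Field F] [DecidableEq F]

/-- If `(0, 0)` has order `5` on `y² + a₁xy + a₃y = x³ + a₂x²`, then `a₂, a₃ ≠ 0`, and the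
coefficients satisfy the relation expressing that `3P = -2P`. -/
theorem coeff_of_order_five {W : WeierstrassCurve F} (h₄ : W.a₄ = 0)
    (h : W.toAffine.Nonsingular 0 0) (h5 : addOrderOf (Affine.Point.some 0 0 h) = 5)
    (h3 : W.a₃ ≠ 0) : W.a₂ ≠ 0 ∧ W.a₃ ^ 2 - W.a₁ * W.a₂ * W.a₃ = -W.a₂ ^ 3 := by
  set P := Affine.Point.some 0 0 h with hP
  have hn : ¬((0 : F) = 0 ∧ (0 : F) = W.toAffine.negY 0 0) := by
    simpa [Affine.negY] using h3
  obtain ⟨ℓ, ν, x₃, h₃, hadd, e₁, -, s₁, s₂, -⟩ := exists_line h h hn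
  have hν : ν = 0 := by linear_combination -e₁
  have hℓ : ℓ = 0 := by
    have : W.a₃ * ℓ = 0 := by
      rw [hν, h₄] at s₂
      linear_combination s₂
    exact (mul_eq_zero.1 this).resolve_left h3
  subst hν hℓ
  obtain rfl : x₃ = -W.a₂ := by linear_combination s₁
  set S := Affine.Point.some (-W.a₂) _ h₃ with hS
  rw [← hP] at hadd
  have h5P : 5 • P = 0 := h5 ▸ addOrderOf_nsmul_eq_zero P
  have hSP : S = -(P + P) := by rw [hadd, neg_neg]
  have hSS : S + S = P := by
    have : S + S - P = -(5 • P) := by rw [hSP]; abel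
    rwa [h5P, neg_zero, sub_eq_zero] at this
  have hP0 : P ≠ 0 := Affine.Point.some_ne_zero h
  constructor
  · intro h2
    have hPS : P = S := by
      rw [hP, hS, Affine.Point.some.injEq]
      simp [h2]
    have : P = 0 := by
      have := hSS
      rw [← hPS] at this
      rwa [add_eq_left] at this
    exact hP0 this
  · have hS2 : ¬(-W.a₂ = -W.a₂ ∧ 0 * -W.a₂ + 0 = W.toAffine.negY (-W.a₂) (0 * -W.a₂ + 0)) := by
      rintro ⟨-, hy⟩
      have h2 : S + S = 0 := Affine.Point.add_self_of_Y_eq hy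
      exact hP0 (hSS ▸ h2)
    obtain ⟨ℓ, ν, x₃, h₃, hadd', e₁, -, s₁, -, -⟩ := exists_line h₃ h₃ hS2
    rw [← hS, hSS, hP, eq_neg_iff_add_eq_zero, add_comm, ← eq_neg_iff_add_eq_zero,
      Affine.Point.neg_some, Affine.Point.some.injEq] at hadd'
    obtain ⟨rfl, hy⟩ := hadd'
    simp only [Affine.negY] at hy
    have hℓ : ℓ * W.a₂ = -W.a₃ := by linear_combination e₁ + hy
    have : -W.a₂ = ℓ ^ 2 + W.a₁ * ℓ := by linear_combination s₁
    linear_combination -W.a₂ ^ 2 * this + (-ℓ * W.a₂ + W.a₃ - W.a₁ * W.a₂) * hℓ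

/-- Every Weierstrass curve with a point of order `5` has a Tate normal form. -/
theorem exists_tateCurve {W : WeierstrassCurve F} {x y : F} (h : W.toAffine.Nonsingular x y)
    (h5 : addOrderOf (Affine.Point.some x y h) = 5) :
    ∃ (t : F) (C : VariableChange F), C • W = tateCurve t ∧ C.r = x ∧ C.t = y := by
  set P := Affine.Point.some x y h with hP
  have hP0 : P ≠ 0 := Affine.Point.some_ne_zero h
  have h5P : 5 • P = 0 := h5 ▸ addOrderOf_nsmul_eq_zero P
  have ha3 : W.a₃ + x * W.a₁ + 2 * y ≠ 0 := by
    intro h0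
    have h2 : P + P = 0 := Affine.Point.add_self_of_Y_eq (by
      simp only [Affine.negY]; linear_combination h0)
    apply hP0
    have : 5 • P = (P + P) + (P + P) + P := by abel
    rwa [h5P, h2, zero_add, zero_add, eq_comm] at this
  set s := (W.a₄ + 2 * x * W.a₂ - y * W.a₁ + 3 * x ^ 2) / (W.a₃ + x * W.a₁ + 2 * y) with hs
  have hs' : s * (W.a₃ + x * W.a₁ + 2 * y) = W.a₄ + 2 * x * W.a₂ - y * W.a₁ + 3 * x ^ 2 := by
    rw [hs, div_mul_cancel₀ _ ha3]
  set C : VariableChange F := ⟨1, x, s, y⟩ with hC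
  set V := C • W with hV
  have h3 : V.a₃ ≠ 0 := by
    simpa [hV, hC, variableChange_a₃] using ha3
  have h4 : V.a₄ = 0 := by
    simp only [hV, hC, variableChange_a₄, inv_one, Units.val_one, one_pow, one_mul]
    linear_combination -hs'
  have h6 : V.a₆ = 0 := by
    have := (Affine.equation_iff ..).1 h.1
    simp only [hV, hC, variableChange_a₆, inv_one, Units.val_one, one_pow, one_mul]
    linear_combination -this
  have hns : V.toAffine.Nonsingular 0 0 := by
    rw [Affine.nonsingular_zero]
    exact ⟨h6, Or.inl h3⟩
  obtain ⟨e, he⟩ := exists_pointEquiv hV.symm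
  obtain ⟨h', he'⟩ := he 0 0 hns
  have hord : addOrderOf (Affine.Point.some 0 0 hns) = 5 := by
    rw [← h5, ← AddEquiv.addOrderOf_eq e, he', hP]
    congr 1
    rw [Affine.Point.some.injEq]
    simp [hC]
  obtain ⟨h2, hrel⟩ := coeff_of_order_five h4 hns hord h3
  refine ⟨-(V.a₂ ^ 3 / V.a₃ ^ 2), ⟨Units.mk0 (V.a₃ / V.a₂) (div_ne_zero h3 h2), 0, 0, 0⟩ * C,
    ?_, ?_, ?_⟩
  · rw [mul_smul, ← hV]
    have e1 : V.a₁ = (V.a₃ ^ 2 + V.a₂ ^ 3) / (V.a₂ * V.a₃) := by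
      rw [eq_div_iff (mul_ne_zero h2 h3)]
      linear_combination -hrel
    ext
    · simp only [variableChange_a₁, tateCurve, Units.val_inv_eq_inv_val, Units.val_mk0, e1]
      field_simp
      ring
    · simp only [variableChange_a₂, tateCurve, Units.val_inv_eq_inv_val, Units.val_mk0]
      field_simp
      ring
    · simp only [variableChange_a₃, tateCurve, Units.val_inv_eq_inv_val, Units.val_mk0]
      field_simp
      ring
    · simp [variableChange_a₄, tateCurve, h4]
    · simp [variableChange_a₆, tateCurve, h6]
  · simp [VariableChange.mul_def, hC]
  · simp [VariableChange.mul_def, hC]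

theorem tatePoint_add_self {t : F} (ht : t ≠ 0) :
    ∃ h, tatePoint ht + tatePoint ht = -.some t 0 h := by
  have h := tateCurve_nonsingular_zero ht
  obtain ⟨ℓ, ν, x₃, h₃, hadd, e₁, -, s₁, s₂, -⟩ := exists_line h h
    (by simpa [Affine.negY, tateCurve] using ht.symm)
  simp only [tateCurve] at s₁ s₂
  have hν : ν = 0 := by linear_combination -e₁
  subst hν
  have hℓ : ℓ = 0 := by
    have : t * ℓ = 0 := by linear_combination -s₂
    exact (mul_eq_zero.1 this).resolve_left ht
  subst hℓ
  obtain rfl : x₃ = t := by linear_combination s₁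
  have e : 0 * x₃ + 0 = (0 : F) := by ring
  exact ⟨e ▸ h₃, by rw [tatePoint, hadd]; congr 2⟩

end TateNormalForm

/-! ### The parameter of the Tate normal form is a fifth power -/

section FifthPower

local notation "ℚbar" => AlgebraicClosure ℚ

theorem tateCurve_map {F L : Type*} [Field F] [Field L] (f : F →+* L) (t : F) :
    (tateCurve t).map f = tateCurve (f t) := by
  ext <;> simp [tateCurve]

/-- The group isomorphism between the points of a Weierstrass curve and of an equal one. -/
theorem exists_pointEquiv_of_eq {F : Type*} [Field F] [DecidableEq F] {W W' : WeierstrassCurve F}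
    (h : W = W') : ∃ e : W.toAffine.Point ≃+ W'.toAffine.Point,
      ∀ x y (hxy : W.toAffine.Nonsingular x y), ∃ h', e (.some x y hxy) = .some x y h' := by
  subst h
  exact ⟨AddEquiv.refl _, fun x y hxy => ⟨hxy, rfl⟩⟩

/-- If `t ^ m` is a fifth power and `5 ∤ m`, then `t` is a fifth power. -/
theorem exists_pow_five_of_coprime {F : Type*} [Field F] {t c : F} (ht : t ≠ 0) {m : ℕ}
    (hm : ¬ 5 ∣ m) (h : t ^ m = c ^ 5) : ∃ d : F, d ^ 5 = t := by
  have hcop : IsCoprime (m : ℤ) 5 := by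
    rw [show (5 : ℤ) = ((5 : ℕ) : ℤ) by norm_num, Nat.isCoprime_iff_coprime, Nat.coprime_comm]
    exact (Nat.Prime.coprime_iff_not_dvd (by norm_num)).2 hm
  obtain ⟨u, v, huv⟩ := hcop
  refine ⟨c ^ u * t ^ v, ?_⟩
  have h1 : (c ^ u * t ^ v) ^ 5 = (c ^ 5) ^ u * t ^ (v * 5) := by
    rw [mul_pow, ← zpow_natCast, ← zpow_natCast (t ^ v), ← zpow_natCast c, ← zpow_mul, ← zpow_mul,
      ← zpow_mul, mul_comm u]
    rfl
  rw [h1, ← h, ← zpow_natCast, ← zpow_mul, ← zpow_add₀ ht, mul_comm (m : ℤ), huv, zpow_one]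

/-- Let `L` be a field in which `5` is not a square, and `R` a point on the Tate normal form over
`L` outside `⟨P⟩` with `5R ∈ ⟨P⟩`, where `P = (0, 0)`.  Then `5R ≠ 0`, and the descent function
shows that `t` is a fifth power in `L`. -/
theorem exists_pow_five_of_division {L : Type*} [Field L] [DecidableEq L] [CharZero L]
    (h5 : ∀ z : L, z ^ 2 ≠ 5) {t : L} (ht : t ≠ 0) (hδ : t ^ 2 - 11 * t - 1 ≠ 0)
    (hP : 5 • tatePoint ht = 0) {R : (tateCurve t).toAffine.Point}
    (hR : R ∉ AddSubgroup.zmultiples (tatePoint ht))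
    (hR5 : 5 • R ∈ AddSubgroup.zmultiples (tatePoint ht)) : ∃ d : L, d ^ 5 = t := by
  obtain ⟨j, hj⟩ := AddSubgroup.mem_zmultiples_iff.1 hR5
  obtain ⟨m, hm⟩ : ∃ m : ℕ, (m : ℤ) = j % 5 :=
    ⟨(j % 5).toNat, Int.toNat_of_nonneg (Int.emod_nonneg _ (by norm_num))⟩
  have hmR : 5 • R = m • tatePoint ht := by
    rw [← hj, ← natCast_zsmul, hm]
    conv_lhs => rw [← Int.emod_add_mul_ediv j 5]
    rw [add_zsmul, mul_comm, mul_zsmul, show (5 : ℤ) • tatePoint ht = 0 by exact_mod_cast hP,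
      smul_zero, add_zero]
  have hm5 : m < 5 := by
    have := Int.emod_lt_of_pos j (show (0 : ℤ) < 5 by norm_num)
    omega
  by_cases hm0 : m = 0
  · exfalso
    rw [hm0, zero_smul] at hmR
    rcases R with _ | ⟨x, y, h⟩
    · exact hR (zero_mem _)
    have he := tateCurve_equation.1 h.1
    have hPm := AddSubgroup.mem_zmultiples (tatePoint ht)
    have hx : x ≠ 0 := by
      rintro rfl
      have : y * (y - t) = 0 := by linear_combination he
      rcases mul_eq_zero.1 this with rfl | hy
      · exact hR hPm
      · apply hR
        have : Affine.Point.some 0 y h = -tatePoint ht := by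
          rw [tatePoint, Affine.Point.neg_some, Affine.Point.some.injEq]
          refine ⟨rfl, ?_⟩
          simp only [Affine.negY, tateCurve]
          linear_combination hy
        rw [this]
        exact neg_mem hPm
    have hxt : x ≠ t := by
      rintro rfl
      obtain ⟨h2, e2⟩ := tatePoint_add_self ht
      have hmem := add_mem hPm hPm
      rw [e2] at hmem
      rcases (Affine.Point.X_eq_iff (h₁ := h) (h₂ := h2)).1 rfl with h' | h'
      · rw [h'] at hR
        exact hR (neg_mem_iff.1 hmem)
      · rw [h'] at hR
        exact hR hmem
    have key := five_mul_sq_of_torsion h hmR hx hxt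
    have hne : (t ^ 2 - 11 * t - 1) * (x * (x - t)) ^ 2 ≠ 0 :=
      mul_ne_zero hδ (pow_ne_zero 2 (mul_ne_zero hx (sub_ne_zero.2 hxt)))
    generalize hA : 2 * (x * (x * (x - t)) ^ 2 + (t ^ 2 - t) * x * (x - t) ^ 2 +
        t ^ 2 * (x - t) ^ 2 + (t ^ 3 + t ^ 2) * (x - t) * x ^ 2 + t ^ 4 * x ^ 2) +
        (t ^ 2 - t + 1) * (x * (x - t)) ^ 2 = A at key
    generalize (t ^ 2 - 11 * t - 1) * (x * (x - t)) ^ 2 = D at key hne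
    apply h5 (5 * A / D)
    rw [div_pow, div_eq_iff (pow_ne_zero 2 hne)]
    linear_combination 5 * key
  · obtain ⟨c, hc, e1⟩ := descentFun_nsmul ht R 5
    obtain ⟨d, hd, e2⟩ := descentFun_nsmul ht (tatePoint ht) m
    rw [hmR, e2, descentFun_tatePoint] at e1
    refine exists_pow_five_of_coprime (m := m) (c := d / (descentFun t R * c)) ht (by omega) ?_
    have hg := descentFun_ne_zero ht R
    rw [div_pow, mul_pow, ← e1, inv_pow]
    field_simp

/-- If a point `R` on the Tate normal form over `ℚ̄` is Galois invariant modulo `⟨P⟩`, and `5R` is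
in `⟨P⟩` but `R` is not, then the parameter `t` is a fifth power in `ℚ`. -/
theorem exists_pow_five_of_galois {t : ℚ} (ht : t ≠ 0) (hδ : t ^ 2 - 11 * t - 1 ≠ 0)
    [DecidableEq ℚbar] {P R : ((tateCurve t).baseChange ℚbar).toAffine.Point}
    (hP0 : ∃ h, P = .some 0 0 h) (hP : 5 • P = 0) (hR : R ∉ AddSubgroup.zmultiples P)
    (hR5 : 5 • R ∈ AddSubgroup.zmultiples P)
    (hσ : ∀ σ : ℚbar →ₐ[ℚ] ℚbar, Affine.Point.map (W' := (tateCurve t).toAffine) σ R - R ∈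
      AddSubgroup.zmultiples P) : ∃ s : ℚ, t = s ^ 5 := by
  obtain ⟨h0, rfl⟩ := hP0
  have hfixP : ∀ σ : ℚbar →ₐ[ℚ] ℚbar, Affine.Point.map (W' := (tateCurve t).toAffine) σ
      (.some 0 0 h0) = .some 0 0 h0 := by
    intro σ
    rw [Affine.Point.map_some, Affine.Point.some.injEq]
    simp
  have hfixR : ∀ σ : ℚbar →ₐ[ℚ] ℚbar,
      (Affine.Point.map (W' := (tateCurve t).toAffine) σ)^[5] R = R := by
    intro σ
    obtain ⟨k, hk⟩ := AddSubgroup.mem_zmultiples_iff.1 (hσ σ)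
    have e : Affine.Point.map (W' := (tateCurve t).toAffine) σ R = R + k • .some 0 0 h0 := by
      rw [hk]; abel
    have : ∀ n : ℕ, (Affine.Point.map (W' := (tateCurve t).toAffine) σ)^[n] R =
        R + n • k • .some 0 0 h0 := by
      intro n
      induction n with
      | zero => simp
      | succ n ih =>
        rw [Function.iterate_succ_apply', ih, map_add, map_nsmul, map_zsmul, hfixP, e, succ_nsmul]
        abel
    rw [this 5, smul_comm, hP, smul_zero, add_zero]
  rcases R with _ | ⟨x, y, h⟩
  · exact absurd (zero_mem _) hR
  have hxy : x ∈ quinticField ∧ y ∈ quinticField := by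
    have : ∀ σ : ℚbar ≃ₐ[ℚ] ℚbar, σ (σ (σ (σ (σ x)))) = x ∧ σ (σ (σ (σ (σ y)))) = y := by
      intro σ
      have := hfixR σ
      simp only [Function.iterate_succ_apply, Function.iterate_zero_apply, Affine.Point.map_some,
        Affine.Point.some.injEq] at this
      exact this
    exact ⟨fun σ => (this σ).1, fun σ => (this σ).2⟩
  -- the points `P` and `R` are defined over `quinticField`
  have hns : ∀ a b : quinticField, ((tateCurve t).baseChange ℚbar).toAffine.Nonsingular
      (a : ℚbar) (b : ℚbar) → ((tateCurve t).baseChange quinticField).toAffine.Nonsingular a b :=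
    fun a b hab => ((tateCurve t).toAffine.baseChange_nonsingular
      (f := quinticField.val) quinticField.val.injective a b).1 hab
  classical
  have hinj := Affine.Point.map_injective (W' := (tateCurve t).toAffine) quinticField.val
  have hb : (tateCurve t).baseChange quinticField = tateCurve (algebraMap ℚ quinticField t) :=
    tateCurve_map _ t
  obtain ⟨e, he⟩ := exists_pointEquiv_of_eq hb
  have htL : algebraMap ℚ quinticField t ≠ 0 := by simpa using ht
  obtain ⟨hR', eR⟩ := he _ _ (hns ⟨x, hxy.1⟩ ⟨y, hxy.2⟩ h)
  obtain ⟨hP', eP⟩ := he _ _ (hns 0 0 h0)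
  set R₀ := Affine.Point.some _ _ (hns ⟨x, hxy.1⟩ ⟨y, hxy.2⟩ h) with hR₀
  set P₀ := Affine.Point.some _ _ (hns 0 0 h0) with hP₀
  have mR : Affine.Point.map (W' := (tateCurve t).toAffine) quinticField.val R₀ = .some x y h := rfl
  have mP : Affine.Point.map (W' := (tateCurve t).toAffine) quinticField.val P₀ = .some 0 0 h0 :=
    rfl
  have eP' : e P₀ = tatePoint htL := eP
  obtain ⟨d, hd⟩ := exists_pow_five_of_division (L := quinticField) (R := e R₀)
    (fun z hz => sq_ne_five_of_mem_quinticField z.2 (congrArg Subtype.val hz))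
    htL
    (by
      intro H
      apply hδ
      apply (algebraMap ℚ quinticField).injective
      rw [map_zero, ← H]
      simp only [map_sub, map_pow, map_mul, map_one, map_ofNat])
    (by
      rw [← eP', ← map_nsmul, ← map_zero e]
      congr 1
      apply hinj
      rw [map_nsmul, mP, hP, map_zero])
    (by
      intro H
      apply hR
      obtain ⟨k, hk⟩ := AddSubgroup.mem_zmultiples_iff.1 H
      rw [← eP', ← map_zsmul] at hk
      rw [AddSubgroup.mem_zmultiples_iff]
      exact ⟨k, by rw [← mR, ← mP, ← map_zsmul, e.injective hk]⟩)
    (by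
      obtain ⟨k, hk⟩ := AddSubgroup.mem_zmultiples_iff.1 hR5
      rw [AddSubgroup.mem_zmultiples_iff]
      refine ⟨k, ?_⟩
      rw [← eP', ← map_zsmul, ← map_nsmul]
      congr 1
      apply hinj
      rw [map_zsmul, map_nsmul, mR, mP, hk])
  exact exists_pow_five_of_quinticField d.2 (congrArg Subtype.val hd)

/-- The Tate normal form of an elliptic curve with a point `P` of order `5`, whose quotient by
`⟨P⟩` again has a rational point of order `5`, has a fifth power as its parameter. -/
theorem exists_tateCurve_pow_five (E : WeierstrassCurve ℚ) [E.IsElliptic]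
    (P : (E.baseChange ℚ).toAffine.Point) (hP : addOrderOf P = 5)
    (E' : WeierstrassCurve ℚ) (hE' : IsQuotientBy E P E')
    (hQ : ∃ Q : (E'.baseChange ℚ).toAffine.Point, addOrderOf Q = 5) :
    ∃ (s : ℚ) (C : VariableChange ℚ), s ≠ 0 ∧ C • E = tateCurve (s ^ 5) := by
  classical
  obtain ⟨Q, hQ⟩ := hQ
  obtain ⟨R, hR, hR5, hRσ⟩ := exists_galois_invariant_mod hP hE' hQ
  have hPbar : 5 • Affine.Point.baseChange ℚ ℚbar P = 0 := by
    rw [← map_nsmul, ← hP, addOrderOf_nsmul_eq_zero, map_zero]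
  rcases P with _ | ⟨x, y, h⟩
  · rw [← Affine.Point.zero_def, addOrderOf_zero] at hP
    norm_num at hP
  have hEQ : E.baseChange ℚ = E := E.map_id
  obtain ⟨e₀, he₀⟩ := exists_pointEquiv_of_eq hEQ
  obtain ⟨h', eh'⟩ := he₀ x y h
  obtain ⟨t, C, hC, hCr, hCt⟩ := exists_tateCurve h' (by
    rw [← hP, ← AddEquiv.addOrderOf_eq e₀, eh'])
  have hΔ : (tateCurve t).Δ ≠ 0 := by
    rw [← hC]
    exact (C • E).isUnit_Δ.ne_zero
  rw [tateCurve_Δ] at hΔ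
  have ht : t ≠ 0 := by
    rintro rfl
    simp at hΔ
  have hδ : t ^ 2 - 11 * t - 1 ≠ 0 := right_ne_zero_of_mul hΔ
  have hCbar : (C.map (algebraMap ℚ ℚbar)) • (E.baseChange ℚbar) =
      (tateCurve t).baseChange ℚbar := by
    rw [← hC]
    exact map_variableChange ..
  obtain ⟨e, he⟩ := exists_pointEquiv hCbar
  have heσ : ∀ (σ : ℚbar →ₐ[ℚ] ℚbar) A, e (Affine.Point.map (W' := (tateCurve t).toAffine) σ A) =
      Affine.Point.map (W' := E.toAffine) σ (e A) := by
    rintro σ (_ | ⟨a, b, hab⟩)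
    · rw [← Affine.Point.zero_def, map_zero, map_zero, map_zero]
    · obtain ⟨h1, e1⟩ := he a b hab
      rw [e1, Affine.Point.map_some, Affine.Point.map_some]
      obtain ⟨h2, e2⟩ := he (σ a) (σ b)
        (((tateCurve t).toAffine.baseChange_nonsingular σ.injective ..).mpr hab)
      rw [e2, Affine.Point.some.injEq]
      simp [VariableChange.map]
  have h00 : ((tateCurve t).baseChange ℚbar).toAffine.Nonsingular 0 0 := by
    have := (((tateCurve t).toAffine.map_nonsingular (algebraMap ℚ ℚbar).injective 0 0)).2
      (tateCurve_nonsingular_zero ht)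
    simpa using this
  have heP : e (.some 0 0 h00) = Affine.Point.baseChange ℚ ℚbar (.some x y h) := by
    obtain ⟨h1, e1⟩ := he 0 0 h00
    rw [e1, Affine.Point.map_some, Affine.Point.some.injEq]
    constructor
    · simp [VariableChange.map, hCr]
    · simp [VariableChange.map, hCt]
  have hmem : ∀ A, A ∈ AddSubgroup.zmultiples (Affine.Point.some 0 0 h00) ↔
      e A ∈ AddSubgroup.zmultiples (Affine.Point.baseChange ℚ ℚbar (.some x y h)) := by
    intro A
    simp only [AddSubgroup.mem_zmultiples_iff, ← heP, ← map_zsmul, e.injective.eq_iff]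
  obtain ⟨s, rfl⟩ := exists_pow_five_of_galois ht hδ (P := .some 0 0 h00) (R := e.symm R)
    ⟨h00, rfl⟩
    (by
      apply e.injective
      rw [map_nsmul, heP, hPbar, map_zero])
    (by rw [hmem, e.apply_symm_apply]; exact hR)
    (by rw [hmem, map_nsmul, e.apply_symm_apply]; exact hR5)
    (by
      intro σ
      rw [hmem, map_sub, heσ, e.apply_symm_apply]
      exact hRσ σ)
  exact ⟨s, C, by rintro rfl; simp at ht, hC⟩

end FifthPower

/-! ### Integrality and smallness in `ℚ_p` -/

section Padic

variable {p : ℕ} [Fact p.Prime]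

theorem int_add {a b : ℚ_[p]} (ha : ‖a‖ ≤ 1) (hb : ‖b‖ ≤ 1) : ‖a + b‖ ≤ 1 :=
  (Padic.nonarchimedean a b).trans (max_le ha hb)

theorem int_neg {a : ℚ_[p]} (ha : ‖a‖ ≤ 1) : ‖-a‖ ≤ 1 := by rwa [norm_neg]

theorem int_sub {a b : ℚ_[p]} (ha : ‖a‖ ≤ 1) (hb : ‖b‖ ≤ 1) : ‖a - b‖ ≤ 1 := by
  rw [sub_eq_add_neg]; exact int_add ha (int_neg hb)

theorem int_mul {a b : ℚ_[p]} (ha : ‖a‖ ≤ 1) (hb : ‖b‖ ≤ 1) : ‖a * b‖ ≤ 1 := by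
  rw [norm_mul]; exact mul_le_one₀ ha (norm_nonneg _) hb

theorem int_pow {a : ℚ_[p]} (ha : ‖a‖ ≤ 1) (n : ℕ) : ‖a ^ n‖ ≤ 1 := by
  rw [norm_pow]; exact pow_le_one₀ (norm_nonneg _) ha

theorem int_one : ‖(1 : ℚ_[p])‖ ≤ 1 := norm_one.le

theorem int_ofNat (n : ℕ) [n.AtLeastTwo] : ‖(OfNat.ofNat n : ℚ_[p])‖ ≤ 1 := by
  have := Padic.norm_int_le_one (p := p) (OfNat.ofNat n)
  exact_mod_cast this

theorem small_add {a b : ℚ_[p]} (ha : ‖a‖ < 1) (hb : ‖b‖ < 1) : ‖a + b‖ < 1 :=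
  (Padic.nonarchimedean a b).trans_lt (max_lt ha hb)

theorem small_neg {a : ℚ_[p]} (ha : ‖a‖ < 1) : ‖-a‖ < 1 := by rwa [norm_neg]

theorem small_sub {a b : ℚ_[p]} (ha : ‖a‖ < 1) (hb : ‖b‖ < 1) : ‖a - b‖ < 1 := by
  rw [sub_eq_add_neg]; exact small_add ha (small_neg hb)

theorem small_mul_int {a b : ℚ_[p]} (ha : ‖a‖ < 1) (hb : ‖b‖ ≤ 1) : ‖a * b‖ < 1 := by
  rw [norm_mul]; exact mul_lt_one_of_nonneg_of_lt_one_left (norm_nonneg _) ha hb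

theorem int_mul_small {a b : ℚ_[p]} (ha : ‖a‖ ≤ 1) (hb : ‖b‖ < 1) : ‖a * b‖ < 1 := by
  rw [mul_comm]; exact small_mul_int hb ha

theorem small_pow {a : ℚ_[p]} (ha : ‖a‖ < 1) {n : ℕ} (hn : n ≠ 0) : ‖a ^ n‖ < 1 := by
  rw [norm_pow]; exact pow_lt_one₀ (norm_nonneg _) ha hn

theorem small_of_pow {a : ℚ_[p]} {n : ℕ} (h : ‖a ^ n‖ < 1) : ‖a‖ < 1 := by
  by_contra hcon
  rw [norm_pow] at h
  exact absurd (one_le_pow₀ (not_lt.1 hcon)) (not_le.2 h)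

theorem small_of_mul {a b : ℚ_[p]} (h : ‖a * b‖ < 1) : ‖a‖ < 1 ∨ ‖b‖ < 1 := by
  by_contra hcon
  push Not at hcon
  rw [norm_mul] at h
  exact absurd (one_le_mul_of_one_le_of_one_le hcon.1 hcon.2) (not_le.2 h)

theorem norm_add_eq_left {a b : ℚ_[p]} (h : ‖b‖ < ‖a‖) : ‖a + b‖ = ‖a‖ := by
  rw [Padic.add_eq_max_of_ne h.ne', max_eq_left h.le]

theorem norm_sub_eq_left {a b : ℚ_[p]} (h : ‖b‖ < ‖a‖) : ‖a - b‖ = ‖a‖ := by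
  rw [sub_eq_add_neg]; exact norm_add_eq_left (by rwa [norm_neg])

theorem norm_one_add_small {a : ℚ_[p]} (ha : ‖a‖ < 1) : ‖1 + a‖ = 1 := by
  rw [norm_add_eq_left (by rwa [norm_one]), norm_one]

theorem valuation_eq_zero {a : ℚ_[p]} (ha : ‖a‖ = 1) : a.valuation = 0 := by
  have h0 : a ≠ 0 := by
    rintro rfl
    simp at ha
  have h1 := Padic.norm_eq_zpow_neg_valuation h0
  rw [ha] at h1
  have hp : (1 : ℝ) < p := by exact_mod_cast (Fact.out : p.Prime).one_lt
  have := (zpow_eq_one_iff_right₀ (by linarith) hp.ne').1 h1.symm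
  linarith

/-- A root of a monic quadratic polynomial with integral coefficients is integral. -/
theorem int_of_sq_eq {z b c : ℚ_[p]} (hb : ‖b‖ ≤ 1) (hc : ‖c‖ ≤ 1) (h : z ^ 2 = b * z + c) :
    ‖z‖ ≤ 1 := by
  by_contra hz
  rw [not_le] at hz
  have h1 : ‖b * z + c‖ ≤ ‖z‖ := by
    refine (Padic.nonarchimedean _ _).trans (max_le ?_ (hc.trans hz.le))
    rw [norm_mul]
    exact mul_le_of_le_one_left (norm_nonneg _) hb
  rw [← h, norm_pow] at h1
  nlinarith

/-- A root of a monic quartic polynomial with integral coefficients and no cubic term is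
integral. -/
theorem int_of_pow_four_eq {z b c d : ℚ_[p]} (hb : ‖b‖ ≤ 1) (hc : ‖c‖ ≤ 1) (hd : ‖d‖ ≤ 1)
    (h : z ^ 4 = b * z ^ 2 + c * z + d) : ‖z‖ ≤ 1 := by
  by_contra hz
  have hz' := not_le.1 hz
  have hz0 : z ≠ 0 := by
    rintro rfl
    simp at hz
  have hi : ‖z⁻¹‖ ≤ 1 := by
    rw [norm_inv]
    exact inv_le_one_of_one_le₀ hz'.le
  apply hz
  refine int_of_sq_eq (b := b * z⁻¹ + c * z⁻¹ ^ 2 + d * z⁻¹ ^ 3) (c := 0)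
    (int_add (int_add (int_mul hb hi) (int_mul hc (int_pow hi 2))) (int_mul hd (int_pow hi 3)))
    (by simp) ?_
  field_simp
  linear_combination h

end Padic

/-! ### The component group of the Tate normal form at a prime dividing `t` -/

section LocalTate

variable {p : ℕ} [Fact p.Prime] {t : ℚ_[p]}

/-- If `p ∣ t` then the reduction of the Tate normal form has a node at `(0, 0)`.  A point is nodal
if it reduces to this node. -/
def IsNodal : (tateCurve t).toAffine.Point → Prop
  | .zero => False
  | .some x y _ => ‖x‖ < 1 ∧ ‖y‖ < 1

theorem IsNodal.neg (ht : ‖t‖ < 1) {A : (tateCurve t).toAffine.Point} (hA : IsNodal A) :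
    IsNodal (-A) := by
  rcases A with _ | ⟨x, y, h⟩
  · exact hA
  · refine ⟨hA.1, ?_⟩
    have : (tateCurve t).toAffine.negY x y = -y - (1 - t) * x + t := by
      simp [Affine.negY, tateCurve]
    rw [this]
    exact small_add (small_sub (small_neg hA.2) (int_mul_small (int_sub int_one ht.le) hA.1)) ht

/-- If one of three collinear points is nodal then so is another one, because every line through
the node of the reduction meets it there with multiplicity at least two. -/
theorem nodal_of_line (ht : ‖t‖ < 1) {ℓ ν x₁ x₂ x₃ : ℚ_[p]}
    (s₁ : x₁ + x₂ + x₃ = ℓ ^ 2 + (1 - t) * ℓ + t)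
    (s₂ : x₁ * x₂ + x₁ * x₃ + x₂ * x₃ = -2 * ℓ * ν - (1 - t) * ν + t * ℓ)
    (h₃ : ‖x₃‖ < 1 ∧ ‖ℓ * x₃ + ν‖ < 1) :
    (‖x₁‖ < 1 ∧ ‖ℓ * x₁ + ν‖ < 1) ∨ (‖x₂‖ < 1 ∧ ‖ℓ * x₂ + ν‖ < 1) := by
  have h1t : ‖1 - t‖ ≤ 1 := int_sub int_one ht.le
  by_cases hℓ : ‖ℓ‖ ≤ 1
  · have hν : ‖ν‖ < 1 := by
      have : ν = (ℓ * x₃ + ν) - ℓ * x₃ := by ring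
      rw [this]
      exact small_sub h₃.2 (int_mul_small hℓ h₃.1)
    have h12 : ‖x₁ * x₂‖ < 1 := by
      have : x₁ * x₂ = t * ℓ - (2 * ℓ + (1 - t)) * ν - x₃ * (ℓ ^ 2 + (1 - t) * ℓ + t - x₃) := by
        linear_combination s₂ - x₃ * s₁
      rw [this]
      refine small_sub (small_sub (small_mul_int ht hℓ) (int_mul_small ?_ hν))
        (small_mul_int h₃.1 ?_)
      · exact int_add (int_mul (int_ofNat 2) hℓ) h1t
      · exact int_sub (int_add (int_add (int_pow hℓ 2) (int_mul h1t hℓ)) ht.le) h₃.1.le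
    rcases small_of_mul h12 with h | h
    · exact Or.inl ⟨h, small_add (int_mul_small hℓ h) hν⟩
    · exact Or.inr ⟨h, small_add (int_mul_small hℓ h) hν⟩
  · -- exchange the roles of the coordinates: the line is `x = μ y + κ` with `μ`, `κ` small
    have hℓ := not_le.1 hℓ
    have hℓ0 : ℓ ≠ 0 := by
      rintro rfl
      simp at hℓ
      linarith
    obtain ⟨μ, hμ⟩ : ∃ μ, μ * ℓ = 1 := ⟨ℓ⁻¹, inv_mul_cancel₀ hℓ0⟩
    have hμs : ‖μ‖ < 1 := by
      have := congrArg norm hμ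
      rw [norm_mul, norm_one] at this
      by_contra hcon
      nlinarith [norm_nonneg μ]
    obtain ⟨κ, hκ⟩ : ∃ κ, κ = -(μ * ν) := ⟨_, rfl⟩
    have hxy : ∀ x, x = μ * (ℓ * x + ν) + κ := by
      intro x
      linear_combination -hκ - x * hμ
    have hνκ : ν = -(ℓ * κ) := by
      linear_combination ℓ * hκ - ν * hμ
    obtain ⟨y₁, hy₁⟩ : ∃ y₁, y₁ = ℓ * x₁ + ν := ⟨_, rfl⟩
    obtain ⟨y₂, hy₂⟩ : ∃ y₂, y₂ = ℓ * x₂ + ν := ⟨_, rfl⟩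
    obtain ⟨y₃, hy₃⟩ : ∃ y₃, y₃ = ℓ * x₃ + ν := ⟨_, rfl⟩
    have hx₁ := hxy x₁
    have hx₂ := hxy x₂
    have hx₃ := hxy x₃
    rw [← hy₁] at hx₁ ⊢
    rw [← hy₂] at hx₂ ⊢
    rw [← hy₃] at hx₃ h₃
    have hκs : ‖κ‖ < 1 := by
      have : κ = x₃ - μ * y₃ := by linear_combination -hx₃
      rw [this]
      exact small_sub h₃.1 (small_mul_int hμs h₃.2.le)
    obtain ⟨c₁, hc₁⟩ : ∃ c₁, c₁ = 3 * μ * κ ^ 2 - 2 * t * μ * κ - (1 - t) * κ + t := ⟨_, rfl⟩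
    obtain ⟨c₂, hc₂⟩ : ∃ c₂, c₂ = 1 + ((1 - t) * μ + t * μ ^ 2 - 3 * μ ^ 2 * κ) := ⟨_, rfl⟩
    have hc₁s : ‖c₁‖ < 1 := by
      rw [hc₁]
      refine small_add (small_sub (small_sub ?_ ?_) (int_mul_small h1t hκs)) ht
      · exact int_mul_small (int_mul (int_ofNat 3) hμs.le) (small_pow hκs two_ne_zero)
      · exact int_mul_small (int_mul (int_mul (int_ofNat 2) ht.le) hμs.le) hκs
    have hc₂u : ‖c₂‖ = 1 := by
      rw [hc₂]
      refine norm_one_add_small (small_sub (small_add (int_mul_small h1t hμs)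
        (small_mul_int ht (int_pow hμs.le 2))) ?_)
      exact int_mul_small (int_mul (int_ofNat 3) (int_pow hμs.le 2)) hκs
    have E1 : μ ^ 3 * (y₁ + y₂ + y₃) = c₂ := by
      have hμ2 : μ ^ 2 * ℓ ^ 2 = 1 := by
        rw [← mul_pow, hμ, one_pow]
      have : μ * (y₁ + y₂ + y₃) = ℓ ^ 2 + (1 - t) * ℓ + t - 3 * κ := by
        linear_combination s₁ - hx₁ - hx₂ - hx₃
      rw [hc₂]
      linear_combination μ ^ 2 * this + hμ2 + (1 - t) * μ * hμ
    have E2 : μ ^ 3 * (y₁ * y₂ + y₁ * y₃ + y₂ * y₃) = c₁ := by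
      have e2 : μ ^ 2 * (y₁ * y₂ + y₁ * y₃ + y₂ * y₃) =
          (-2 * ℓ * ν - (1 - t) * ν + t * ℓ) - 2 * κ * (ℓ ^ 2 + (1 - t) * ℓ + t) + 3 * κ ^ 2 := by
        rw [← s₁, ← s₂, hx₁, hx₂, hx₃]
        ring
      rw [hνκ] at e2
      rw [hc₁]
      linear_combination μ * e2 + (t - (1 - t) * κ) * hμ
    have hμ0 : μ ^ 3 ≠ 0 := by
      apply pow_ne_zero
      rintro rfl
      simp at hμ
    have E3 : c₂ * (y₁ * y₂) = (c₁ - y₃ * c₂) * (y₁ + y₂) + c₁ * y₃ := by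
      rw [← E1, ← E2]
      ring
    by_cases h1 : ‖y₁‖ < 1
    · left
      exact ⟨by rw [hx₁]; exact small_add (small_mul_int hμs h1.le) hκs, h1⟩
    by_cases h2 : ‖y₂‖ < 1
    · right
      exact ⟨by rw [hx₂]; exact small_add (small_mul_int hμs h2.le) hκs, h2⟩
    exfalso
    rw [not_lt] at h1 h2
    have hδ : ‖c₁ - y₃ * c₂‖ < 1 := small_sub hc₁s (small_mul_int h₃.2 hc₂u.le)
    have hη : ‖c₁ * y₃‖ < 1 := small_mul_int hc₁s h₃.2.le
    have hle := Padic.nonarchimedean ((c₁ - y₃ * c₂) * (y₁ + y₂)) (c₁ * y₃)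
    rw [← E3, norm_mul, norm_mul, norm_mul, hc₂u, one_mul] at hle
    have hm := Padic.nonarchimedean y₁ y₂
    have hprod : max ‖y₁‖ ‖y₂‖ ≤ ‖y₁‖ * ‖y₂‖ := by
      apply max_le <;> nlinarith
    have hmax1 : 1 ≤ max ‖y₁‖ ‖y₂‖ := h1.trans (le_max_left _ _)
    have : max (‖c₁ - y₃ * c₂‖ * ‖y₁ + y₂‖) ‖c₁ * y₃‖ < max ‖y₁‖ ‖y₂‖ := by
      apply max_lt
      · nlinarith [norm_nonneg (c₁ - y₃ * c₂), norm_nonneg (y₁ + y₂)]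
      · linarith
    linarith

/-- The subgroup of points of nonsingular reduction on the Tate normal form with `p ∣ t`. -/
def smoothSubgroup (ht : ‖t‖ < 1) [DecidableEq ℚ_[p]] :
    AddSubgroup (tateCurve t).toAffine.Point where
  carrier := {A | ¬IsNodal A}
  zero_mem' := fun h => h
  neg_mem' := by
    intro A hA h
    exact hA (by simpa using h.neg ht)
  add_mem' := by
    intro A B hA hB hAB
    rcases A with _ | ⟨x₁, y₁, h₁⟩
    · rw [← Affine.Point.zero_def, zero_add] at hAB
      exact hB hAB
    rcases B with _ | ⟨x₂, y₂, h₂⟩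
    · rw [← Affine.Point.zero_def, add_zero] at hAB
      exact hA hAB
    by_cases hxy : x₁ = x₂ ∧ y₁ = (tateCurve t).toAffine.negY x₂ y₂
    · rw [Affine.Point.add_of_Y_eq hxy.1 hxy.2] at hAB
      exact hAB
    · obtain ⟨ℓ, ν, x₃, h₃, hadd, e₁, e₂, s₁, s₂, -⟩ := exists_line h₁ h₂ hxy
      have hn := hAB.neg ht
      rw [hadd, neg_neg] at hn
      simp only [tateCurve] at s₁ s₂
      subst e₁ e₂
      rcases nodal_of_line ht (x₁ := x₁) (x₂ := x₂) (x₃ := x₃) (ℓ := ℓ) (ν := ν)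
        (by linear_combination s₁) (by linear_combination s₂) hn with h | h
      · exact hA h
      · exact hB h

theorem mem_smoothSubgroup (ht : ‖t‖ < 1) [DecidableEq ℚ_[p]] {A : (tateCurve t).toAffine.Point} :
    A ∈ smoothSubgroup ht ↔ ¬IsNodal A := Iff.rfl

/-- The descent function has valuation divisible by `5` at points of nonsingular reduction. -/
theorem five_dvd_valuation_of_not_nodal (ht0 : t ≠ 0) (ht : ‖t‖ < 1)
    {A : (tateCurve t).toAffine.Point} (hA : ¬IsNodal A) :
    (5 : ℤ) ∣ (descentFun t A).valuation := by
  rcases A with _ | ⟨x, y, h⟩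
  · rw [← Affine.Point.zero_def, descentFun_zero, Padic.valuation_one]
    exact dvd_zero 5
  have h00 : ¬(x = 0 ∧ y = 0) := by
    rintro ⟨rfl, rfl⟩
    exact hA ⟨by simp, by simp⟩
  have hne := descentFun_ne_zero ht0 (.some x y h)
  rw [descentFun_some h h00] at hne ⊢
  have he := tateCurve_equation.1 h.1
  have h1t : ‖1 - t‖ ≤ 1 := int_sub int_one ht.le
  by_cases hx : ‖x‖ ≤ 1
  · have hy : ‖y‖ ≤ 1 := by
      refine int_of_sq_eq (b := t - (1 - t) * x) (c := x ^ 3 - t * x ^ 2)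
        (int_sub ht.le (int_mul h1t hx)) (int_sub (int_pow hx 3) (int_mul ht.le (int_pow hx 2))) ?_
      linear_combination he
    have hf : ‖(x + 1) * y - x ^ 2‖ = 1 := by
      refine le_antisymm (int_sub (int_mul (int_add hx int_one) hy) (int_pow hx 2)) ?_
      by_contra hcon
      rw [not_le] at hcon
      -- the product of the values at the point and at its negative is `-x ^ 5`
      have hx5 : ‖x ^ 5‖ < 1 := by
        have : x ^ 5 = ((x + 1) * y - x ^ 2) * (-((x + 1) * (-y - (1 - t) * x + t) - x ^ 2)) := by
          linear_combination (-(x + 1) ^ 2) * he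
        rw [this]
        refine small_mul_int hcon (int_neg (int_sub (int_mul (int_add hx int_one) ?_)
          (int_pow hx 2)))
        exact int_add (int_sub (int_neg hy) (int_mul h1t hx)) ht.le
      have hxs := small_of_pow hx5
      have hy2 : ‖y ^ 2‖ < 1 := by
        have : y ^ 2 = x * (x ^ 2 - t * x - (1 - t) * y) + t * y := by linear_combination he
        rw [this]
        exact small_add (small_mul_int hxs (int_sub (int_sub (int_pow hx 2) (int_mul ht.le hx))
          (int_mul h1t hy))) (small_mul_int ht hy)
      exact hA ⟨hxs, small_of_pow hy2⟩
    rw [valuation_eq_zero hf]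
    exact dvd_zero 5
  · -- at a point reducing to infinity `2 v(y) = 3 v(x)`, and `x * y` is the dominant term
    rw [not_le] at hx
    have hx0 : x ≠ 0 := by
      rintro rfl
      simp at hx
      linarith
    have hR : ‖x ^ 3 - t * x ^ 2‖ = ‖x‖ ^ 3 := by
      rw [norm_sub_eq_left, norm_pow]
      rw [norm_mul, norm_pow, norm_pow]
      nlinarith [norm_nonneg t, pow_pos (zero_lt_one.trans hx) 2]
    have hxy : ‖x‖ < ‖y‖ := by
      by_contra hcon
      rw [not_lt] at hcon
      have h2 : ‖y ^ 2 + (1 - t) * x * y - t * y‖ ≤ ‖x‖ ^ 2 := by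
        rw [sub_eq_add_neg]
        refine (Padic.nonarchimedean _ _).trans (max_le ((Padic.nonarchimedean _ _).trans
          (max_le ?_ ?_)) ?_)
        · rw [norm_pow]
          exact pow_le_pow_left₀ (norm_nonneg _) hcon 2
        · rw [norm_mul, norm_mul]
          have := mul_le_of_le_one_left (norm_nonneg x) h1t
          nlinarith [norm_nonneg x, norm_nonneg y]
        · rw [norm_neg, norm_mul]
          nlinarith [norm_nonneg x, norm_nonneg y, norm_nonneg t]
      rw [he, hR] at h2
      nlinarith [pow_pos (zero_lt_one.trans hx) 2]
    have hy0 : y ≠ 0 := by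
      rintro rfl
      simp at hxy
      linarith [norm_nonneg x]
    have hL : ‖y ^ 2 + (1 - t) * x * y - t * y‖ = ‖y‖ ^ 2 := by
      have h2 : ‖(1 - t) * x * y‖ < ‖y ^ 2‖ := by
        rw [norm_mul, norm_mul, norm_pow]
        have := mul_le_of_le_one_left (norm_nonneg x) h1t
        nlinarith [norm_nonneg x, norm_nonneg y]
      have h3 : ‖y ^ 2 + (1 - t) * x * y‖ = ‖y‖ ^ 2 := by rw [norm_add_eq_left h2, norm_pow]
      rw [norm_sub_eq_left, h3]
      rw [h3, norm_mul]
      nlinarith [norm_nonneg y, norm_nonneg t]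
    have hxyn : ‖y‖ ^ 2 = ‖x‖ ^ 3 := by rw [← hL, he, hR]
    have hfn : ‖(x + 1) * y - x ^ 2‖ = ‖x * y‖ := by
      have e : (x + 1) * y - x ^ 2 = x * y + (y - x ^ 2) := by ring
      rw [e]
      apply norm_add_eq_left
      rw [sub_eq_add_neg]
      refine (Padic.nonarchimedean _ _).trans_lt (max_lt ?_ ?_)
      · rw [norm_mul]
        nlinarith [norm_nonneg y]
      · rw [norm_neg, norm_mul, norm_pow]
        nlinarith [norm_nonneg y]
    have hp : (1 : ℝ) < p := by exact_mod_cast (Fact.out : p.Prime).one_lt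
    have hinj := zpow_right_injective₀ (zero_lt_one.trans hp) hp.ne'
    have hv1 : ((x + 1) * y - x ^ 2).valuation = x.valuation + y.valuation := by
      rw [Padic.norm_eq_zpow_neg_valuation hne,
        Padic.norm_eq_zpow_neg_valuation (mul_ne_zero hx0 hy0), Padic.valuation_mul hx0 hy0] at hfn
      have := hinj hfn
      linarith
    have hv2 : 2 * y.valuation = 3 * x.valuation := by
      rw [← norm_pow, ← norm_pow, Padic.norm_eq_zpow_neg_valuation (pow_ne_zero 2 hy0),
        Padic.norm_eq_zpow_neg_valuation (pow_ne_zero 3 hx0), Padic.valuation_pow,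
        Padic.valuation_pow] at hxyn
      have := hinj hxyn
      push_cast at this
      linarith
    omega

theorem five_nsmul_tatePoint {F : Type*} [Field F] [DecidableEq F] {t : F} (ht : t ≠ 0) :
    5 • tatePoint ht = 0 := by
  obtain ⟨h, e⟩ := tatePoint_add_self ht
  set S := Affine.Point.some t 0 h with hS
  have hn : ¬(t = t ∧ (0 : F) = (tateCurve t).toAffine.negY t 0) := by
    rintro ⟨-, h0⟩
    simp only [Affine.negY, tateCurve] at h0
    apply ht
    have : t ^ 2 = 0 := by linear_combination -h0
    simpa using this
  obtain ⟨ℓ, ν, x₃, h₃, hadd, e₁, -, s₁, -, s₃⟩ := exists_line h h hn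
  simp only [tateCurve] at s₁ s₃
  have hν : ν = -(ℓ * t) := by linear_combination -e₁
  have hx₃ : x₃ = ℓ ^ 2 + ℓ := by
    refine mul_left_cancel₀ (pow_ne_zero 2 ht) ?_
    rw [hν] at s₃
    linear_combination s₃
  have hℓ : ℓ = -1 := by
    refine mul_left_cancel₀ ht ?_
    linear_combination s₁ - hx₃
  have hSS : S + S = tatePoint ht := by
    rw [hS, hadd, tatePoint, Affine.Point.neg_some, Affine.Point.some.injEq]
    have hx0 : x₃ = 0 := by rw [hx₃, hℓ]; ring
    refine ⟨hx0, ?_⟩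
    simp only [Affine.negY, tateCurve, hx0, hν, hℓ]
    ring
  calc 5 • tatePoint ht = (tatePoint ht + tatePoint ht) + (tatePoint ht + tatePoint ht) +
        tatePoint ht := by abel
    _ = 0 := by rw [e, ← hSS]; abel

/-- Hensel's lemma gives a point of the Tate normal form at which the descent function has
valuation `1`: one with `x = p` and `y = pz`, where `z ≡ -1` modulo `p`. -/
theorem exists_valuation_eq_one (ht0 : t ≠ 0) (ht : ‖t / p‖ < 1) :
    ∃ A : (tateCurve t).toAffine.Point, (descentFun t A).valuation = 1 := by
  have hp0 : (p : ℚ_[p]) ≠ 0 := by exact_mod_cast (Fact.out : p.Prime).ne_zero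
  have hps : ‖(p : ℚ_[p])‖ < 1 := Padic.norm_p_lt_one
  have htp : t = t / p * p := by field_simp
  have hts : ‖t‖ < 1 := by rw [htp]; exact small_mul_int ht hps.le
  -- the equation for `z`
  obtain ⟨b, hb⟩ : ∃ b : ℤ_[p], (b : ℚ_[p]) = 1 - t - t / p :=
    ⟨⟨_, int_sub (int_sub int_one hts.le) ht.le⟩, rfl⟩
  obtain ⟨c, hc⟩ : ∃ c : ℤ_[p], (c : ℚ_[p]) = t - p := ⟨⟨_, int_sub hts.le hps.le⟩, rfl⟩
  set f : Polynomial ℤ_[p] := Polynomial.X ^ 2 + Polynomial.C b * Polynomial.X + Polynomial.C c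
    with hf
  have hb1 : ‖(-1 + b : ℤ_[p])‖ < 1 := by
    rw [PadicInt.norm_def]
    have : ((-1 + b : ℤ_[p]) : ℚ_[p]) = -t - t / p := by
      push_cast
      rw [hb]
      ring
    rw [this]
    exact small_sub (small_neg hts) ht
  have hcs : ‖c‖ < 1 := by
    rw [PadicInt.norm_def, hc]
    exact small_sub hts hps
  have hder : ‖f.derivative.aeval (-1 : ℤ_[p])‖ = 1 := by
    have : f.derivative.aeval (-1 : ℤ_[p]) = -1 + (-1 + b) := by
      simp [hf]
      ring
    rw [this, PadicInt.norm_add_eq_max_of_ne, norm_neg, norm_one, max_eq_left hb1.le]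
    rw [norm_neg, norm_one]
    exact hb1.ne'
  have hval : ‖f.aeval (-1 : ℤ_[p])‖ < 1 := by
    have : f.aeval (-1 : ℤ_[p]) = -(-1 + b) + c := by
      simp [hf]
      ring
    rw [this]
    exact PadicInt.norm_lt_one_add (by rwa [norm_neg]) hcs
  obtain ⟨z, hz, hz1, -⟩ := hensels_lemma (F := f) (a := (-1 : ℤ_[p])) (by
    rw [hder]; simpa using hval)
  rw [hder] at hz1
  have hzn : ‖(z : ℚ_[p])‖ = 1 := by
    rw [← PadicInt.norm_def]
    have : z = -1 + (z - -1) := by ring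
    rw [this, PadicInt.norm_add_eq_max_of_ne, norm_neg, norm_one, max_eq_left hz1.le]
    rw [norm_neg, norm_one]
    exact hz1.ne'
  have hz' : (z : ℚ_[p]) ^ 2 + (1 - t - t / p) * z + (t - p) = 0 := by
    have := congrArg (fun w : ℤ_[p] => (w : ℚ_[p])) hz
    rw [← hb, ← hc]
    simpa [hf] using this
  have heq : (tateCurve t).toAffine.Equation (p : ℚ_[p]) (p * z) := by
    rw [tateCurve_equation]
    have h1 : t * (p * z) = (t / p) * p ^ 2 * z := by field_simp
    rw [h1]
    linear_combination (p : ℚ_[p]) ^ 2 * hz'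
  have hΔ : (tateCurve t).Δ ≠ 0 := by
    rw [tateCurve_Δ]
    refine mul_ne_zero (pow_ne_zero 5 ht0) fun h => ?_
    have : ‖t ^ 2 - 11 * t‖ < 1 := small_sub (small_pow hts two_ne_zero)
      (int_mul_small (int_ofNat 11) hts)
    rw [sub_eq_zero.1 h, norm_one] at this
    exact lt_irrefl _ this
  have hns := (Affine.equation_iff_nonsingular_of_Δ_ne_zero hΔ).1 heq
  refine ⟨.some _ _ hns, ?_⟩
  rw [descentFun_some _ (by simp [hp0])]
  have e : ((p : ℚ_[p]) + 1) * (p * z) - (p : ℚ_[p]) ^ 2 = p * (z + p * (z - 1)) := by ring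
  have hw : ‖(z : ℚ_[p]) + p * (z - 1)‖ = 1 := by
    rw [norm_add_eq_left, hzn]
    rw [hzn]
    exact small_mul_int hps (int_sub hzn.le int_one)
  have hw0 : (z : ℚ_[p]) + p * (z - 1) ≠ 0 := by
    intro h0
    rw [h0] at hw
    simp at hw
  rw [e, Padic.valuation_mul hp0 hw0, Padic.valuation_p, valuation_eq_zero hw, add_zero]

/-- The valuation modulo `5` of the descent function, as a homomorphism. -/
noncomputable def descentHom (ht0 : t ≠ 0) [DecidableEq ℚ_[p]] : (tateCurve t).toAffine.Point →+ ZMod 5 :=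
  AddMonoidHom.mk' (fun A => ((descentFun t A).valuation : ZMod 5)) fun A B => by
    obtain ⟨c, hc, e⟩ := descentFun_add ht0 A B
    have hA := descentFun_ne_zero ht0 A
    have hB := descentFun_ne_zero ht0 B
    rw [e, Padic.valuation_mul (mul_ne_zero hA hB) (pow_ne_zero 5 hc), Padic.valuation_mul hA hB,
      Padic.valuation_pow]
    have h5 : ((5 : ℕ) : ZMod 5) = 0 := ZMod.natCast_self 5
    push_cast at h5 ⊢
    rw [h5, zero_mul, add_zero]

/-- If `5 ∣ v(t)` and `v(t) > 0`, then the component group of the Tate normal form has order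
divisible by `25`: the homomorphism `descentHom` maps it onto `ℤ/5`, and its kernel contains the
class of the point `(0, 0)`, of order `5`. -/
theorem dvd_index_smoothSubgroup (ht0 : t ≠ 0) (ht : ‖t‖ < 1) (ht' : ‖t / p‖ < 1)
    (h5 : (5 : ℤ) ∣ t.valuation) [DecidableEq ℚ_[p]] : 25 ∣ (smoothSubgroup ht).index := by
  set f := descentHom ht0 with hf
  have hle : smoothSubgroup ht ≤ f.ker := by
    intro A hA
    rw [AddMonoidHom.mem_ker]
    exact (ZMod.intCast_zmod_eq_zero_iff_dvd _ 5).2 (five_dvd_valuation_of_not_nodal ht0 ht hA)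
  have hsurj : Function.Surjective f := by
    obtain ⟨A, hA⟩ := exists_valuation_eq_one ht0 ht'
    intro k
    refine ⟨k.val • A, ?_⟩
    have h1 : f A = 1 := by
      change ((descentFun t A).valuation : ZMod 5) = 1
      rw [hA, Int.cast_one]
    rw [map_nsmul, h1, nsmul_one, ZMod.natCast_zmod_val]
  have hker : f.ker.index = 5 := by
    rw [AddSubgroup.index_ker, AddMonoidHom.range_eq_top.2 hsurj]
    simp
  have hPker : tatePoint ht0 ∈ f.ker := by
    rw [AddMonoidHom.mem_ker]
    refine (ZMod.intCast_zmod_eq_zero_iff_dvd _ 5).2 ?_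
    rw [descentFun_tatePoint, Padic.valuation_inv]
    exact (dvd_neg).2 h5
  have hP : tatePoint ht0 ∉ smoothSubgroup ht := by
    rw [mem_smoothSubgroup, not_not]
    exact ⟨by simp, by simp⟩
  have hrel : 5 ∣ (smoothSubgroup ht).relIndex f.ker := by
    rw [AddSubgroup.relIndex, AddSubgroup.index]
    set q : f.ker ⧸ (smoothSubgroup ht).addSubgroupOf f.ker :=
      QuotientAddGroup.mk ⟨tatePoint ht0, hPker⟩ with hq
    have hq5 : addOrderOf q = 5 := by
      have : Fact (Nat.Prime 5) := ⟨by norm_num⟩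
      refine addOrderOf_eq_prime (p := 5) ?_ ?_
      · have : 5 • (⟨tatePoint ht0, hPker⟩ : f.ker) = 0 :=
          Subtype.ext (five_nsmul_tatePoint ht0)
        rw [hq, ← QuotientAddGroup.mk_nsmul, this, QuotientAddGroup.mk_zero]
      · rw [hq, ne_eq, QuotientAddGroup.eq_zero_iff, AddSubgroup.mem_addSubgroupOf]
        exact hP
    have hdvd := addOrderOf_dvd_natCard q
    rwa [hq5] at hdvd
  rw [← AddSubgroup.relIndex_mul_index hle, hker]
  exact mul_dvd_mul_right hrel 5

end LocalTate

/-! ### Minimal Weierstrass equations at a prime -/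

section Minimal

variable {p : ℕ} [Fact p.Prime]

theorem isIntegral_iff_norm {W : WeierstrassCurve ℚ_[p]} : IsIntegral ℤ_[p] W ↔
    ‖W.a₁‖ ≤ 1 ∧ ‖W.a₂‖ ≤ 1 ∧ ‖W.a₃‖ ≤ 1 ∧ ‖W.a₄‖ ≤ 1 ∧ ‖W.a₆‖ ≤ 1 := by
  constructor
  · intro h
    rw [← integralModel_a₁_eq ℤ_[p] W, ← integralModel_a₂_eq ℤ_[p] W,
      ← integralModel_a₃_eq ℤ_[p] W, ← integralModel_a₄_eq ℤ_[p] W, ← integralModel_a₆_eq ℤ_[p] W]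
    exact ⟨PadicInt.norm_le_one _, PadicInt.norm_le_one _, PadicInt.norm_le_one _,
      PadicInt.norm_le_one _, PadicInt.norm_le_one _⟩
  · rintro ⟨h₁, h₂, h₃, h₄, h₆⟩
    exact isIntegral_of_exists_lift _ ⟨⟨_, h₁⟩, rfl⟩ ⟨⟨_, h₂⟩, rfl⟩ ⟨⟨_, h₃⟩, rfl⟩ ⟨⟨_, h₄⟩, rfl⟩
      ⟨⟨_, h₆⟩, rfl⟩

theorem norm_Δ_le_one (W : WeierstrassCurve ℚ_[p]) [IsIntegral ℤ_[p] W] : ‖W.Δ‖ ≤ 1 := by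
  rw [← integralModel_Δ_eq ℤ_[p] W]
  exact PadicInt.norm_le_one _

/-- The discriminant of a minimal equation has the largest absolute value among all integral
equations. -/
theorem norm_Δ_le_of_isMinimal {W M : WeierstrassCurve ℚ_[p]} [M.IsMinimal ℤ_[p]]
    [IsIntegral ℤ_[p] W] {C : VariableChange ℚ_[p]} (h : C • W = M) (hM : M.Δ ≠ 0) :
    ‖W.Δ‖ ≤ ‖M.Δ‖ := by
  have hW : C⁻¹ • M = W := by rw [← h, inv_smul_smul]
  have hint : IsIntegral ℤ_[p] (C⁻¹ • M) := by rwa [hW]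
  have hmax := IsMinimal.val_Δ_maximal (R := ℤ_[p]) (W := M)
  have hle : valuation_Δ_aux ℤ_[p] (C⁻¹ • M) ≤
      valuation_Δ_aux ℤ_[p] ((1 : VariableChange ℚ_[p]) • M) := by
    rcases le_total (valuation_Δ_aux ℤ_[p] (C⁻¹ • M))
      (valuation_Δ_aux ℤ_[p] ((1 : VariableChange ℚ_[p]) • M)) with h | h
    · exact h
    · exact hmax.2 hint h
  rw [hW, one_smul] at hle
  have hle' := Subtype.coe_le_coe.2 hle
  rw [valuation_Δ_aux_eq_of_isIntegral, valuation_Δ_aux_eq_of_isIntegral] at hle'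
  obtain ⟨a, ha⟩ := IsDiscreteValuationRing.exists_lift_of_le_one (A := ℤ_[p])
    (x := W.Δ / M.Δ) (by
      rw [map_div₀]
      exact div_le_one_of_le₀ hle' zero_le)
  have hn : ‖W.Δ / M.Δ‖ ≤ 1 := by
    rw [← ha]
    exact PadicInt.norm_le_one a
  rwa [norm_div, div_le_one (norm_pos_iff.2 hM)] at hn

theorem residue_eq_zero_iff_norm {z : ℤ_[p]} :
    IsLocalRing.residue ℤ_[p] z = 0 ↔ ‖(z : ℚ_[p])‖ < 1 := by
  rw [IsLocalRing.residue_eq_zero_iff, IsLocalRing.mem_maximalIdeal, PadicInt.mem_nonunits,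
    PadicInt.norm_def]

/-- At an integral point of nonsingular reduction the two partial derivatives of the Weierstrass
equation are not both small. -/
theorem not_small_of_nonsingularReduction {M : WeierstrassCurve ℚ_[p]} [M.IsMinimal ℤ_[p]]
    {x y : ℚ_[p]} {h : M.toAffine.Nonsingular x y}
    (hns : NonsingularReduction ℤ_[p] M (.some x y h)) (hx : ‖x‖ ≤ 1) (hy : ‖y‖ ≤ 1)
    (hX : ‖M.a₁ * y - (3 * x ^ 2 + 2 * M.a₂ * x + M.a₄)‖ < 1) : ¬ ‖2 * y + M.a₁ * x + M.a₃‖ < 1 := by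
  intro hY
  have key := hns ⟨x, hx⟩ ⟨y, hy⟩ rfl rfl
  rw [Affine.nonsingular_iff] at key
  set x₀ : ℤ_[p] := ⟨x, hx⟩
  set y₀ : ℤ_[p] := ⟨y, hy⟩
  have e₁ := integralModel_a₁_eq ℤ_[p] M
  have e₂ := integralModel_a₂_eq ℤ_[p] M
  have e₃ := integralModel_a₃_eq ℤ_[p] M
  have e₄ := integralModel_a₄_eq ℤ_[p] M
  set I := integralModel ℤ_[p] M with hI
  rw [PadicInt.algebraMap_apply] at e₁ e₂ e₃ e₄
  rw [← e₁, ← e₂, ← e₄] at hX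
  rw [← e₁, ← e₃] at hY
  have hX' : IsLocalRing.residue ℤ_[p]
      (I.a₁ * y₀ - (3 * x₀ ^ 2 + 2 * I.a₂ * x₀ + I.a₄)) = 0 := by
    rw [residue_eq_zero_iff_norm]
    push_cast
    exact hX
  have hY' : IsLocalRing.residue ℤ_[p] (2 * y₀ + I.a₁ * x₀ + I.a₃) = 0 := by
    rw [residue_eq_zero_iff_norm]
    push_cast
    exact hY
  simp only [map_sub, map_add, map_mul, map_pow, map_ofNat] at hX' hY'
  have r₁ : (M.reduction ℤ_[p]).a₁ = IsLocalRing.residue ℤ_[p] I.a₁ := rfl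
  have r₂ : (M.reduction ℤ_[p]).a₂ = IsLocalRing.residue ℤ_[p] I.a₂ := rfl
  have r₃ : (M.reduction ℤ_[p]).a₃ = IsLocalRing.residue ℤ_[p] I.a₃ := rfl
  have r₄ : (M.reduction ℤ_[p]).a₄ = IsLocalRing.residue ℤ_[p] I.a₄ := rfl
  rw [r₁, r₂, r₃, r₄] at key
  rcases key.2 with h | h
  · exact h (by linear_combination hX')
  · exact h (by linear_combination hY')

/-- A curve with an integral equation of unit discriminant has local Tamagawa number one. -/
theorem localTamagawa_eq_one {W : WeierstrassCurve ℚ_[p]} [IsIntegral ℤ_[p] W] (h : ‖W.Δ‖ = 1) :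
    localTamagawa ℤ_[p] W = 1 := by
  classical
  have hM : (W.minimal ℤ_[p]).Δ ≠ 0 := by
    have hW : W.Δ ≠ 0 := norm_pos_iff.1 (by rw [h]; exact one_pos)
    rw [minimal, variableChange_Δ]
    exact mul_ne_zero (pow_ne_zero _ (Units.ne_zero _)) hW
  have hle := norm_Δ_le_of_isMinimal (W := W) (M := W.minimal ℤ_[p]) rfl hM
  have hell : ((W.minimal ℤ_[p]).reduction ℤ_[p]).Δ ≠ 0 := by
    change ((integralModel ℤ_[p] (W.minimal ℤ_[p])).map (IsLocalRing.residue ℤ_[p])).Δ ≠ 0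
    rw [map_Δ, ne_eq, residue_eq_zero_iff_norm, ← PadicInt.algebraMap_apply, integralModel_Δ_eq,
      not_lt, ← h]
    exact hle
  have htop : nonsingularSubgroup ℤ_[p] (W.minimal ℤ_[p]) = ⊤ := by
    refine top_unique fun A _ => AddSubgroup.subset_closure ?_
    rcases A with _ | ⟨x, y, hxy⟩
    · trivial
    · rintro x₀ y₀ rfl rfl
      rw [← Affine.equation_iff_nonsingular_of_Δ_ne_zero hell]
      have heq := hxy.1
      rw [← baseChange_integralModel_eq ℤ_[p] (W.minimal ℤ_[p])] at heq
      have heq' : (integralModel ℤ_[p] (W.minimal ℤ_[p])).toAffine.Equation x₀ y₀ :=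
        (Affine.map_equation _ (FaithfulSMul.algebraMap_injective ℤ_[p] ℚ_[p]) x₀ y₀).1 heq
      exact heq'.map _
  rw [localTamagawa, htop, AddSubgroup.index_top]

end Minimal

section TateMinimal

variable {p : ℕ} [Fact p.Prime] {t : ℚ_[p]}

theorem isIntegral_tateCurve (ht : ‖t‖ ≤ 1) : IsIntegral ℤ_[p] (tateCurve t) :=
  isIntegral_iff_norm.2 ⟨int_sub int_one ht, int_neg ht, int_neg ht, by simp [tateCurve],
    by simp [tateCurve]⟩

/-- The reduction of the Tate normal form at a prime dividing `t` is nodal, so it is a minimal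
equation. Thus any other minimal equation differs from it by an integral change of variables. -/
theorem integral_of_isMinimal_tateCurve (ht0 : t ≠ 0) (ht : ‖t‖ < 1) {M : WeierstrassCurve ℚ_[p]}
    [M.IsMinimal ℤ_[p]] {C : VariableChange ℚ_[p]} (h : C • tateCurve t = M) :
    ‖(C.u : ℚ_[p])‖ = 1 ∧ ‖C.r‖ ≤ 1 ∧ ‖C.s‖ ≤ 1 ∧ ‖C.t‖ ≤ 1 := by
  have := isIntegral_tateCurve ht.le
  have htne : t ^ 2 - 11 * t - 1 ≠ 0 := by
    intro h
    have hs : ‖t ^ 2 - 11 * t‖ < 1 := small_sub (small_pow ht two_ne_zero)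
      (int_mul_small (int_ofNat 11) ht)
    rw [sub_eq_zero.1 h, norm_one] at hs
    exact lt_irrefl _ hs
  have hΔ : (tateCurve t).Δ ≠ 0 := by
    rw [tateCurve_Δ]
    exact mul_ne_zero (pow_ne_zero 5 ht0) htne
  have hu0 : (C.u : ℚ_[p]) ≠ 0 := Units.ne_zero _
  have hMΔ : (C.u : ℚ_[p]) ^ 12 * M.Δ = (tateCurve t).Δ := by
    rw [← h, variableChange_Δ, Units.val_inv_eq_inv_val]
    field_simp
  have hM0 : M.Δ ≠ 0 := right_ne_zero_of_mul (hMΔ ▸ hΔ)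
  have hu1 : ‖(C.u : ℚ_[p])‖ ≤ 1 := by
    have hle := norm_Δ_le_of_isMinimal h hM0
    rw [← hMΔ, norm_mul, norm_pow, mul_le_iff_le_one_left (norm_pos_iff.2 hM0)] at hle
    exact (pow_le_one_iff_of_nonneg (norm_nonneg _) (by norm_num)).1 hle
  have hMc : (C.u : ℚ_[p]) ^ 4 * M.c₄ = (tateCurve t).c₄ := by
    rw [← h, variableChange_c₄, Units.val_inv_eq_inv_val]
    field_simp
  have hTc : ‖(tateCurve t).c₄‖ = 1 := by
    have e : (tateCurve t).c₄ = 1 + t * (t ^ 3 - 12 * t ^ 2 + 14 * t + 12) := by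
      simp only [tateCurve, WeierstrassCurve.c₄, WeierstrassCurve.b₂, WeierstrassCurve.b₄]
      ring
    rw [e]
    refine norm_one_add_small (small_mul_int ht ?_)
    exact int_add (int_add (int_sub (int_pow ht.le 3) (int_mul (int_ofNat 12) (int_pow ht.le 2)))
      (int_mul (int_ofNat 14) ht.le)) (int_ofNat 12)
  have hu : ‖(C.u : ℚ_[p])‖ = 1 := by
    have hMc1 : ‖M.c₄‖ ≤ 1 := by
      rw [← integralModel_c₄_eq ℤ_[p] M]
      exact PadicInt.norm_le_one _
    refine le_antisymm hu1 (not_lt.1 fun hlt => ?_)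
    have := small_mul_int (small_pow hlt four_ne_zero) hMc1
    rw [hMc, hTc] at this
    exact lt_irrefl _ this
  obtain ⟨-, i₂, -, -, i₆⟩ := isIntegral_iff_norm.1 (inferInstance : IsIntegral ℤ_[p] M)
  have i₆' : ‖M.b₆‖ ≤ 1 := by
    rw [← integralModel_b₆_eq ℤ_[p] M]
    exact PadicInt.norm_le_one _
  have i₈' : ‖M.b₈‖ ≤ 1 := by
    rw [← integralModel_b₈_eq ℤ_[p] M]
    exact PadicInt.norm_le_one _
  have j₄ : ‖(tateCurve t).b₄‖ ≤ 1 := by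
    rw [← integralModel_b₄_eq ℤ_[p] (tateCurve t)]
    exact PadicInt.norm_le_one _
  have j₆ : ‖(tateCurve t).b₆‖ ≤ 1 := by
    rw [← integralModel_b₆_eq ℤ_[p] (tateCurve t)]
    exact PadicInt.norm_le_one _
  have j₈ : ‖(tateCurve t).b₈‖ ≤ 1 := by
    rw [← integralModel_b₈_eq ℤ_[p] (tateCurve t)]
    exact PadicInt.norm_le_one _
  have k₂ : (C.u : ℚ_[p]) ^ 2 * M.a₂ = -t - C.s * (1 - t) + 3 * C.r - C.s ^ 2 := by
    rw [← h, variableChange_a₂, Units.val_inv_eq_inv_val]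
    simp only [tateCurve]
    field_simp
  have k₆ : (C.u : ℚ_[p]) ^ 6 * M.a₆ =
      -C.r ^ 2 * t + C.r ^ 3 + C.t * t - C.t ^ 2 - C.r * C.t * (1 - t) := by
    rw [← h, variableChange_a₆, Units.val_inv_eq_inv_val]
    simp only [tateCurve]
    field_simp
    ring
  have k₆' : (C.u : ℚ_[p]) ^ 6 * M.b₆ = (tateCurve t).b₆ + 2 * C.r * (tateCurve t).b₄ +
      C.r ^ 2 * (tateCurve t).b₂ + 4 * C.r ^ 3 := by
    rw [← h, variableChange_b₆, Units.val_inv_eq_inv_val]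
    field_simp
  have k₈' : (C.u : ℚ_[p]) ^ 8 * M.b₈ = (tateCurve t).b₈ + 3 * C.r * (tateCurve t).b₆ +
      3 * C.r ^ 2 * (tateCurve t).b₄ + C.r ^ 3 * (tateCurve t).b₂ + 3 * C.r ^ 4 := by
    rw [← h, variableChange_b₈, Units.val_inv_eq_inv_val]
    field_simp
  have hr : ‖C.r‖ ≤ 1 := by
    -- eliminating `b₂` from the transformation rules of `b₆` and `b₈` gives a monic quartic for `r`
    refine int_of_pow_four_eq (b := (tateCurve t).b₄)
      (c := 2 * (tateCurve t).b₆ + (C.u : ℚ_[p]) ^ 6 * M.b₆)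
      (d := (tateCurve t).b₈ - (C.u : ℚ_[p]) ^ 8 * M.b₈) j₄
      (int_add (int_mul (int_ofNat 2) j₆) (int_mul (int_pow hu1 6) i₆'))
      (int_sub j₈ (int_mul (int_pow hu1 8) i₈')) ?_
    linear_combination k₈' - C.r * k₆'
  refine ⟨hu, hr, ?_, ?_⟩
  · refine int_of_sq_eq (b := -(1 - t)) (c := -t + 3 * C.r - (C.u : ℚ_[p]) ^ 2 * M.a₂)
      (int_neg (int_sub int_one ht.le)) (int_sub (int_add (int_neg ht.le)
        (int_mul (int_ofNat 3) hr)) (int_mul (int_pow hu1 2) i₂)) ?_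
    linear_combination k₂
  · refine int_of_sq_eq (b := t - C.r * (1 - t))
      (c := -C.r ^ 2 * t + C.r ^ 3 - (C.u : ℚ_[p]) ^ 6 * M.a₆)
      (int_sub ht.le (int_mul hr (int_sub int_one ht.le)))
      (int_sub (int_add (int_mul (int_neg (int_pow hr 2)) ht.le) (int_pow hr 3))
        (int_mul (int_pow hu1 6) i₆)) ?_
    linear_combination k₆

/-- Points of nonsingular reduction on a minimal equation are not nodal on the Tate normal
form. -/
theorem not_isNodal_of_nonsingularReduction (ht0 : t ≠ 0) (ht : ‖t‖ < 1)
    {M : WeierstrassCurve ℚ_[p]} [M.IsMinimal ℤ_[p]] {C : VariableChange ℚ_[p]}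
    (h : C • tateCurve t = M) {x y : ℚ_[p]} {hxy : M.toAffine.Nonsingular x y}
    (hns : NonsingularReduction ℤ_[p] M (.some x y hxy))
    (hx : ‖(C.u : ℚ_[p]) ^ 2 * x + C.r‖ < 1) :
    ¬ ‖(C.u : ℚ_[p]) ^ 3 * y + (C.u : ℚ_[p]) ^ 2 * C.s * x + C.t‖ < 1 := by
  intro hy
  obtain ⟨hu, hr, hs, ht'⟩ := integral_of_isMinimal_tateCurve ht0 ht h
  have hu0 : (C.u : ℚ_[p]) ≠ 0 := Units.ne_zero _
  have ea₁ : M.a₁ = (C.u : ℚ_[p])⁻¹ * (1 - t + 2 * C.s) := by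
    rw [← h, variableChange_a₁, Units.val_inv_eq_inv_val, tateCurve]
  have ea₂ : M.a₂ = (C.u : ℚ_[p])⁻¹ ^ 2 * (-t - C.s * (1 - t) + 3 * C.r - C.s ^ 2) := by
    rw [← h, variableChange_a₂, Units.val_inv_eq_inv_val, tateCurve]
  have ea₃ : M.a₃ = (C.u : ℚ_[p])⁻¹ ^ 3 * (-t + C.r * (1 - t) + 2 * C.t) := by
    rw [← h, variableChange_a₃, Units.val_inv_eq_inv_val, tateCurve]
  have ea₄ : M.a₄ = (C.u : ℚ_[p])⁻¹ ^ 4 * (0 - C.s * -t + 2 * C.r * -t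
      - (C.t + C.r * C.s) * (1 - t) + 3 * C.r ^ 2 - 2 * C.s * C.t) := by
    rw [← h, variableChange_a₄, Units.val_inv_eq_inv_val, tateCurve]
  set u : ℚ_[p] := (C.u : ℚ_[p]) with hu_def
  set x' := u ^ 2 * x + C.r with hx'
  set y' := u ^ 3 * y + u ^ 2 * C.s * x + C.t with hy'
  have hui : ‖u⁻¹‖ ≤ 1 := by rw [norm_inv, hu, inv_one]
  have ex : x = u⁻¹ ^ 2 * (x' - C.r) := by
    rw [hx']
    field_simp
    ring
  have ey : y = u⁻¹ ^ 3 * (y' - C.s * (x' - C.r) - C.t) := by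
    rw [hx', hy']
    field_simp
    ring
  have hTX : ‖(1 - t) * y' - (3 * x' ^ 2 - 2 * t * x')‖ < 1 :=
    small_sub (int_mul_small (int_sub int_one ht.le) hy) (small_sub
      (int_mul_small (int_ofNat 3) (small_pow hx two_ne_zero))
      (int_mul_small (int_mul (int_ofNat 2) ht.le) hx))
  have hTY : ‖2 * y' + (1 - t) * x' - t‖ < 1 :=
    small_sub (small_add (int_mul_small (int_ofNat 2) hy)
      (int_mul_small (int_sub int_one ht.le) hx)) ht
  refine not_small_of_nonsingularReduction hns ?_ ?_ ?_ ?_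
  · rw [ex]
    exact int_mul (int_pow hui 2) (int_sub hx.le hr)
  · rw [ey]
    exact int_mul (int_pow hui 3) (int_sub (int_sub hy.le (int_mul hs (int_sub hx.le hr))) ht')
  · have e : M.a₁ * y - (3 * x ^ 2 + 2 * M.a₂ * x + M.a₄) = u⁻¹ ^ 4 *
        ((1 - t) * y' - (3 * x' ^ 2 - 2 * t * x') + C.s * (2 * y' + (1 - t) * x' - t)) := by
      rw [ex, ey, ea₁, ea₂, ea₄]
      ring
    rw [e]
    exact int_mul_small (int_pow hui 4) (small_add hTX (int_mul_small hs hTY))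
  · have e : 2 * y + M.a₁ * x + M.a₃ = u⁻¹ ^ 3 * (2 * y' + (1 - t) * x' - t) := by
      rw [ex, ey, ea₁, ea₃]
      ring
    rw [e]
    exact int_mul_small (int_pow hui 3) hTY

/-- The local Tamagawa number of a curve with Tate normal form of parameter `t` is divisible by
`25` if `v(t)` is positive and divisible by `5`. -/
theorem dvd_localTamagawa (ht0 : t ≠ 0) (ht : ‖t‖ < 1) (ht' : ‖t / p‖ < 1)
    (h5 : (5 : ℤ) ∣ t.valuation) {W : WeierstrassCurve ℚ_[p]} {C : VariableChange ℚ_[p]}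
    (hW : C • tateCurve t = W) : 25 ∣ localTamagawa ℤ_[p] W := by
  classical
  obtain ⟨D, hD⟩ : ∃ D : VariableChange ℚ_[p], D • tateCurve t = W.minimal ℤ_[p] :=
    ⟨_ * C, by rw [mul_smul, hW]; rfl⟩
  obtain ⟨e, he⟩ := exists_pointEquiv hD
  have hle : nonsingularSubgroup ℤ_[p] (W.minimal ℤ_[p]) ≤
      (smoothSubgroup ht).comap e.toAddMonoidHom := by
    refine (AddSubgroup.closure_le _).2 fun A hA => ?_
    rcases A with _ | ⟨x, y, hxy⟩
    · exact zero_mem _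
    · obtain ⟨h', e'⟩ := he x y hxy
      change e (.some x y hxy) ∈ smoothSubgroup ht
      rw [e', mem_smoothSubgroup]
      exact fun hn => not_isNodal_of_nonsingularReduction ht0 ht hD (hxy := hxy) hA hn.1 hn.2
  have hidx := AddSubgroup.index_dvd_of_le hle
  rw [AddSubgroup.index_comap_of_surjective _ e.surjective] at hidx
  exact Nat.dvd_trans (dvd_index_smoothSubgroup ht0 ht ht' h5) hidx

end TateMinimal

/-! ### Global Tamagawa numbers -/

section Global

local notation "ℚbar" => AlgebraicClosure ℚ

local instance factPrime (p : Nat.Primes) : Fact (p : ℕ).Prime := ⟨p.2⟩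

theorem finite_setOf_not_norm_le_one (q : ℚ) :
    {p : Nat.Primes | ¬ ‖(q : ℚ_[(p : ℕ)])‖ ≤ 1}.Finite := by
  refine Set.Finite.of_finite_image (f := ((↑) : Nat.Primes → ℕ)) ?_
    Subtype.val_injective.injOn
  refine (Finset.finite_toSet q.den.primeFactors).subset ?_
  rintro _ ⟨p, hp, rfl⟩
  refine Nat.mem_primeFactors.2 ⟨p.2, ?_, q.den_ne_zero⟩
  by_contra h
  exact hp (Padic.norm_rat_le_one h)

/-- Almost all local Tamagawa numbers of an elliptic curve are one. -/
theorem finite_tamagawaAt_ne_one (W : WeierstrassCurve ℚ) [W.IsElliptic] :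
    {p : Nat.Primes | tamagawaAt W p ≠ 1}.Finite := by
  have hfin := (finite_setOf_not_norm_le_one W.a₁).union
    ((finite_setOf_not_norm_le_one W.a₂).union ((finite_setOf_not_norm_le_one W.a₃).union
    ((finite_setOf_not_norm_le_one W.a₄).union ((finite_setOf_not_norm_le_one W.a₆).union
    (finite_setOf_not_norm_le_one W.Δ⁻¹)))))
  refine hfin.subset fun p hp => ?_
  by_contra hcon
  simp only [Set.mem_union, Set.mem_ofPred_eq, not_or, not_not] at hcon
  obtain ⟨h₁, h₂, h₃, h₄, h₆, hΔ⟩ := hcon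
  have hint : IsIntegral ℤ_[(p : ℕ)] (W.baseChange ℚ_[(p : ℕ)]) := by
    rw [isIntegral_iff_norm]
    simp only [baseChange, map_a₁, map_a₂, map_a₃, map_a₄, map_a₆, eq_ratCast]
    exact ⟨h₁, h₂, h₃, h₄, h₆⟩
  refine hp (localTamagawa_eq_one (le_antisymm (norm_Δ_le_one _) ?_))
  rw [baseChange, map_Δ, eq_ratCast]
  rw [Rat.cast_inv, norm_inv] at hΔ
  have h0 : ((W.Δ : ℚ) : ℚ_[(p : ℕ)]) ≠ 0 := Rat.cast_ne_zero.2 W.isUnit_Δ.ne_zero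
  exact (inv_le_one₀ (norm_pos_iff.2 h0)).1 hΔ

theorem tamagawaAt_dvd_tamagawa (W : WeierstrassCurve ℚ) [W.IsElliptic] (p : Nat.Primes) :
    tamagawaAt W p ∣ tamagawa W :=
  finprod_mem_dvd (f := fun p : Nat.Primes => tamagawaAt W p) p (finite_tamagawaAt_ne_one W)

/-- A prime dividing the parameter `s ^ 5` contributes a factor `25` to the Tamagawa number. -/
theorem dvd_tamagawa {W : WeierstrassCurve ℚ} [W.IsElliptic] {C : VariableChange ℚ} {s : ℚ}
    (hs0 : s ≠ 0) (hW : C • tateCurve (s ^ 5) = W) (p : Nat.Primes)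
    (hp : ‖(s : ℚ_[(p : ℕ)])‖ < 1) : 25 ∣ tamagawa W := by
  refine dvd_trans ?_ (tamagawaAt_dvd_tamagawa W p)
  have hs0' : (s : ℚ_[(p : ℕ)]) ≠ 0 := Rat.cast_ne_zero.2 hs0
  have hp0 : ((p : ℕ) : ℚ_[(p : ℕ)]) ≠ 0 := Nat.cast_ne_zero.2 p.2.ne_zero
  have hdiv : ‖(s : ℚ_[(p : ℕ)]) / (p : ℕ)‖ ≤ 1 := by
    obtain ⟨c, hc⟩ := (PadicInt.norm_lt_one_iff_dvd (p := p) ⟨s, hp.le⟩).1 hp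
    have hc' : (s : ℚ_[(p : ℕ)]) = (p : ℕ) * (c : ℚ_[(p : ℕ)]) :=
      congrArg (fun z : ℤ_[(p : ℕ)] => (z : ℚ_[(p : ℕ)])) hc
    rw [hc', mul_div_cancel_left₀ _ hp0]
    exact PadicInt.norm_le_one c
  refine dvd_localTamagawa (t := (s : ℚ_[(p : ℕ)]) ^ 5) (pow_ne_zero 5 hs0')
    (small_pow hp (by norm_num)) ?_ ?_ (C := C.map (algebraMap ℚ ℚ_[(p : ℕ)])) ?_
  · rw [pow_succ, mul_div_assoc]
    exact small_mul_int (small_pow hp four_ne_zero) hdiv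
  · rw [Padic.valuation_pow]
    exact Dvd.intro _ rfl
  · have e : tateCurve ((s : ℚ_[(p : ℕ)]) ^ 5) =
        (tateCurve (s ^ 5)).map (algebraMap ℚ ℚ_[(p : ℕ)]) := by
      rw [tateCurve_map, map_pow, eq_ratCast]
    rw [e, map_variableChange, hW]
    rfl

theorem exists_norm_lt_one {s : ℚ} (hs : s.num.natAbs ≠ 1) :
    ∃ p : Nat.Primes, ‖(s : ℚ_[(p : ℕ)])‖ < 1 := by
  obtain ⟨q, hq, hdvd⟩ := Nat.exists_prime_and_dvd hs
  refine ⟨⟨q, hq⟩, ?_⟩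
  have : Fact q.Prime := ⟨hq⟩
  change ‖(s : ℚ_[q])‖ < 1
  have hnum : ‖(s.num : ℚ_[q])‖ < 1 := Padic.norm_intCast_lt_one_iff.2 (Int.natCast_dvd.2 hdvd)
  have hden : ‖(s.den : ℚ_[q])‖ = 1 :=
    Padic.norm_natCast_eq_one_iff.2 (Nat.Coprime.coprime_dvd_left hdvd s.reduced)
  rwa [Rat.cast_def, norm_div, hden, div_one]

/-- Taking the point `-2P = (t, 0)` as the new origin changes the parameter `t` into `-1 / t`. -/
theorem tateCurve_neg_inv {F : Type*} [Field F] {t : F} (ht : t ≠ 0) :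
    (⟨-Units.mk0 t ht, t, -1, 0⟩ : VariableChange F) • tateCurve t = tateCurve (-t⁻¹) := by
  ext <;> simp only [tateCurve, variableChange_def, Units.val_inv_eq_inv_val, Units.val_neg,
    Units.val_mk0] <;> field_simp <;> ring

theorem exists_variableChange_norm_lt_one {s : ℚ} (hs0 : s ≠ 0) (h1 : s ≠ 1) (h1' : s ≠ -1) :
    ∃ (s' : ℚ) (C : VariableChange ℚ) (p : Nat.Primes), s' ≠ 0 ∧
      C • tateCurve (s' ^ 5) = tateCurve (s ^ 5) ∧ ‖(s' : ℚ_[(p : ℕ)])‖ < 1 := by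
  by_cases hn : s.num.natAbs = 1
  · have hd : s⁻¹.num.natAbs ≠ 1 := by
      intro hd
      have hsq : s.num * s.num = 1 := Int.isUnit_mul_self (Int.isUnit_iff_natAbs_eq.2 hn)
      have hinv : s⁻¹ = ((s.num * s.den : ℤ) : ℚ) := by
        refine inv_eq_of_mul_eq_one_right ?_
        have hsq' : (s.num : ℚ) * s.num = 1 := by exact_mod_cast hsq
        push_cast
        rw [mul_left_comm, Rat.mul_den_eq_num, hsq']
      have hd' : s.den = 1 := by
        rwa [hinv, Rat.num_intCast, Int.natAbs_mul, hn, one_mul, Int.natAbs_natCast] at hd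
      have hs : (s.num : ℚ) = s := by
        conv_rhs => rw [← Rat.num_div_den s, hd', Nat.cast_one, div_one]
      rcases Int.natAbs_eq_iff.1 hn with h | h
      · exact h1 (by rw [← hs, h]; norm_num)
      · exact h1' (by rw [← hs, h]; norm_num)
    obtain ⟨p, hp⟩ := exists_norm_lt_one hd
    have h0 : (-s⁻¹) ^ 5 ≠ 0 := pow_ne_zero 5 (neg_ne_zero.2 (inv_ne_zero hs0))
    refine ⟨-s⁻¹, _, p, neg_ne_zero.2 (inv_ne_zero hs0), (tateCurve_neg_inv h0).trans ?_, ?_⟩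
    · congr 1
      field_simp
    · rwa [Rat.cast_neg, norm_neg]
  · obtain ⟨p, hp⟩ := exists_norm_lt_one hn
    exact ⟨s, 1, p, hs0, one_smul _ _, hp⟩

/-! ### Isomorphic curves are isogenous -/

open Polynomial in
theorem isogenous_of_smul_eq {W W' : WeierstrassCurve ℚ} [W.IsElliptic] {C : VariableChange ℚ}
    (h : C • W = W') : Isogenous W' W := by
  classical
  have hbar : C.map (algebraMap ℚ ℚbar) • W.baseChange ℚbar = W'.baseChange ℚbar := by
    subst h
    exact map_variableChange ..
  have : W'.IsElliptic := h ▸ inferInstance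
  obtain ⟨e, he⟩ := exists_pointEquiv hbar
  refine ⟨⟨e.toAddMonoidHom, Polynomial.C (Polynomial.C ((C.u : ℚ) ^ 2) * X + Polynomial.C C.r),
    Polynomial.C (Polynomial.C ((C.u : ℚ) ^ 3)) * Y +
      Polynomial.C (Polynomial.C ((C.u : ℚ) ^ 2 * C.s) * X + Polynomial.C C.t), 1, ?_, ?_⟩⟩
  · have := infinite_point (W'.baseChange ℚbar)
    obtain ⟨A, hA⟩ := exists_ne (0 : (W'.baseChange ℚbar).toAffine.Point)
    rcases A with _ | ⟨x, y, hxy⟩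
    · exact absurd rfl hA
    · exact ⟨x, y, hxy, by simp⟩
  · intro x y hxy _
    obtain ⟨h', e'⟩ := he x y hxy
    have ex : aevalAeval x y (Polynomial.C (Polynomial.C ((C.u : ℚ) ^ 2) * X + Polynomial.C C.r)) /
        aevalAeval x y (1 : ℚ[X][Y]) = ((C.map (algebraMap ℚ ℚbar)).u : ℚbar) ^ 2 * x +
          (C.map (algebraMap ℚ ℚbar)).r := by
      simp [VariableChange.map]
    have ey : aevalAeval x y (Polynomial.C (Polynomial.C ((C.u : ℚ) ^ 3)) * Y +
        Polynomial.C (Polynomial.C ((C.u : ℚ) ^ 2 * C.s) * X + Polynomial.C C.t)) /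
        aevalAeval x y (1 : ℚ[X][Y]) = ((C.map (algebraMap ℚ ℚbar)).u : ℚbar) ^ 3 * y +
          ((C.map (algebraMap ℚ ℚbar)).u : ℚbar) ^ 2 * (C.map (algebraMap ℚ ℚbar)).s * x +
          (C.map (algebraMap ℚ ℚbar)).t := by
      simp [VariableChange.map]
      ring
    rw [ex, ey]
    exact ⟨h', e'⟩

instance isElliptic_curve11a3 : curve11a3.IsElliptic := by
  rw [isElliptic_iff, isUnit_iff_ne_zero]
  norm_num [curve11a3, WeierstrassCurve.Δ, WeierstrassCurve.b₂, WeierstrassCurve.b₄,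
    WeierstrassCurve.b₆, WeierstrassCurve.b₈]

theorem exists_smul_curve11a3_eq :
    ∃ C : VariableChange ℚ, C • curve11a3 = tateCurve 1 := by
  refine ⟨⟨-1, 0, 0, 0⟩, ?_⟩
  ext <;> norm_num [tateCurve, curve11a3, variableChange_def]

/-- The parameters `1` and `-1` belong to the curve `y² + y = x³ - x²`. -/
theorem isogenous_curve11a3 {E : WeierstrassCurve ℚ} {C : VariableChange ℚ} {s : ℚ}
    (hE : C • E = tateCurve (s ^ 5)) (hs : s = 1 ∨ s = -1) : Isogenous E curve11a3 := by
  obtain ⟨D, hD⟩ := exists_smul_curve11a3_eq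
  obtain ⟨D', hD'⟩ : ∃ D' : VariableChange ℚ, D' • curve11a3 = tateCurve (s ^ 5) := by
    rcases hs with rfl | rfl
    · exact ⟨D, by rw [hD, one_pow]⟩
    · refine ⟨⟨-Units.mk0 1 one_ne_zero, 1, -1, 0⟩ * D, ?_⟩
      rw [mul_smul, hD, tateCurve_neg_inv one_ne_zero]
      norm_num
  refine isogenous_of_smul_eq (C := C⁻¹ * D') ?_
  rw [mul_smul, hD', ← hE, inv_smul_smul]

end Global

end EllipticTamagawa

theorem corollary5p2 (E : WeierstrassCurve ℚ) [E.IsElliptic]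
    (P : (E.baseChange ℚ).toAffine.Point) (hP : addOrderOf P = 5)
    (E' : WeierstrassCurve ℚ) [E'.IsElliptic]
    (hE' : EllipticTamagawa.IsQuotientBy E P E')
    (hQ : ∃ Q : (E'.baseChange ℚ).toAffine.Point, addOrderOf Q = 5)
    (h11 : ¬ EllipticTamagawa.Isogenous E EllipticTamagawa.curve11a3) :
    EllipticTamagawa.DvdProduct 25
      (fun C : EllipticTamagawa.IsogenyClass E => C.tamagawa) := by
  obtain ⟨s, C, hs0, hC⟩ := EllipticTamagawa.exists_tateCurve_pow_five E P hP E' hE' hQ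
  obtain ⟨s', D, p, hs0', hD, hp⟩ := EllipticTamagawa.exists_variableChange_norm_lt_one hs0
    (fun h => h11 (EllipticTamagawa.isogenous_curve11a3 hC (Or.inl h)))
    (fun h => h11 (EllipticTamagawa.isogenous_curve11a3 hC (Or.inr h)))
  let c : {W : WeierstrassCurve ℚ // W.IsElliptic ∧ EllipticTamagawa.Isogenous E W} :=
    ⟨E, inferInstance,
      EllipticTamagawa.isogenous_of_smul_eq (one_smul (WeierstrassCurve.VariableChange ℚ) E)⟩
  let q : EllipticTamagawa.IsogenyClass E := Quotient.mk (EllipticTamagawa.isomSetoid E) c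
  -- the chosen representative of the class of `E` is a change of variables of `E`
  obtain ⟨g, hg⟩ : ∃ g : WeierstrassCurve.VariableChange ℚ, g • E = (Quotient.out q).1 :=
    Quotient.mk_out (s := EllipticTamagawa.isomSetoid E) c
  have hell : (Quotient.out q).1.IsElliptic := (Quotient.out q).2.1
  have hdvd : 25 ∣ q.tamagawa := by
    refine EllipticTamagawa.dvd_tamagawa (C := g * C⁻¹ * D) hs0' ?_ p hp
    rw [mul_smul, mul_smul, hD, ← hC, inv_smul_smul, hg]
  refine (Filter.eventually_ge_atTop {q}).mono fun S hS => ?_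
  exact hdvd.trans (Finset.dvd_prod_of_mem _ (hS (Finset.mem_singleton_self q)))
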